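/- All logarithms without a base are binary. For a word $w$ over an alphabet and a word $v$, let $|w|_v$ be the number of (possibly overlapping) occurrences of $v$ in $w$, with $|w|_\epsilon = |w|$, and let $$H_k(w) = -\frac{1}{|w|}\sum_{|v|=k,\ a\text{ a letter}} |w|_{va}\log\frac{|w|_{va}}{|w|_v}$$ (vanishing counts contribute $0$) be the $k$-th order empirical entropy. A full grammar $(S',G)$ consists of a starting string $S'$ and rules $X\to \mathrm{rhs}(X)$, one for each nonterminal $X$; its size is the total length of $S'$ and of all right-hand sides of $G$. The algorithm Greedy starts with $S'=S$ and no rules. In each round it chooses a word $w$ with $|w|\ge 2$ that has at least two pairwise non-overlapping occurrences in $S'$ and the right-hand sides of $G$, replaces at least two pairwise non-overlapping occurrences of $w$ by a fresh nonterminal $X$, and adds the rule $X\to w$; the choice is made so that the size of the resulting full grammar is the smallest possible (ties are broken arbitrarily). It stops when there is no such word. As usual for grammar compressors, it is understood that no two nonterminals of the produced grammar have the same expansion; no such assumption is needed if the occurrences of the chosen word are always replaced from left to right. The entropy encoding of $(S',G)$ applies an entropy coder to the concatenation $S_G$ of $S'$ and all right-hand sides of $G$, and stores the lengths of the right-hand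 sides of the nonterminals in unary; it takes $$|S_G|H_0(S_G) + c\,|S_G| + \sum_{X}\bigl(|\mathrm{rhs}(X)|+1\bigr)$$ bits, where the constant $c$ is the overhead of the entropy coder per symbol. Theorem. Let $S$, $|S|=n$, be a string over an alphabet of size $\sigma\ge 2$ and let $k=o(\log_\sigma n)$. Then the entropy encoding of any full grammar produced by Greedy on $S$ takes at most $\frac32|S|H_k(S)+o(|S|\log\sigma)$ bits. Explicitly: for every $c$ and every $\varepsilon>0$ there are $\delta>0$ and $N$ such that for all $\sigma\ge 2$, all $n\ge N$, all $k\ge 0$ with $k\le\delta\log_\sigma n$, all strings $S$ of length $n$ over an alphabet of size $\sigma$, and every full grammar produced by Greedy on $S$, the entropy encoding takes at most $\frac32|S|H_k(S)+\varepsilon|S|\log\sigma$ bits. -/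

import Mathlib

noncomputable section

/-- `|w|_v`: the number of (possibly overlapping) occurrences of `v` in `w`; as only the starting
positions `i < |w|` are counted, `|w|_ε = |w|`. -/
def occ {β : Type} [DecidableEq β] (w v : List β) : ℕ :=
  (List.range w.length).countP (fun i => decide (v <+: w.drop i))

/-- The finite set of all subwords of `w` of length `m`. -/
def subwords {β : Type} [DecidableEq β] (m : ℕ) (w : List β) : Finset (List β) :=
  ((List.range w.length).map (fun i => (w.drop i).take m)).toFinset.filter (fun u => u.length = m)

/-- The `k`-th order empirical entropy
`H_k(w) = -(1/|w|) ∑_{|v| = k, a letter} |w|_{va} log₂ (|w|_{va} / |w|_v)`.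
The sum runs over the words `u = va` that occur in `w` (so `v = u.dropLast`); all other
terms are `0` by convention. -/
def empEntropy {β : Type} [DecidableEq β] (k : ℕ) (w : List β) : ℝ :=
  -(1 / (w.length : ℝ)) *
    ∑ u ∈ subwords (k + 1) w, (occ w u : ℝ) * Real.logb 2 ((occ w u : ℝ) / (occ w u.dropLast : ℝ))

/-- Replace the non-overlapping occurrences of `w` (a nonempty word), chosen greedily from left to
right, by the symbol `x`. -/
def replaceLeft {β : Type} [DecidableEq β] (w : List β) (x : β) : List β → List β
  | [] => []
  | a :: s =>
    if w <+: a :: s then x :: replaceLeft w x (s.drop (w.length - 1))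
    else a :: replaceLeft w x s
termination_by s => s.length
decreasing_by
  · simp only [List.length_drop, List.length_cons]; omega
  · simp only [List.length_cons]; omega

/-- Grammar symbols: `Sum.inl a` is a letter, `Sum.inr i` is the nonterminal number `i`. -/
abbrev GSym (α : Type) : Type := α ⊕ ℕ

/-- A full grammar `(S', G)`: the starting string `S'` and the list of right-hand sides of the
rules of `G`; the nonterminals are `0, …, rules.length - 1`, and the rule of the nonterminal `i`
is `i → rules[i]`. -/
structure FullGrammar (α : Type) where
  start : List (GSym α)
  rules : List (List (GSym α))

namespace FullGrammar

variable {α : Type}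

/-- The concatenation of the starting string and all right-hand sides of the rules. -/
def rhs (g : FullGrammar α) : List (GSym α) := g.start ++ g.rules.flatten

/-- The size of the full grammar: the total length of its right-hand sides. -/
def size (g : FullGrammar α) : ℕ := g.rhs.length

/-- The trivial full grammar of a string: no rules. -/
def ofString (S : List α) : FullGrammar α := ⟨S.map Sum.inl, []⟩

/-- The nonterminal that the next added rule will define. -/
def freshSym (g : FullGrammar α) : GSym α := Sum.inr g.rules.length

/-- `g.Expands u v`: the word `v` of letters is the expansion of the word `u` of symbols. -/
inductive Expands (g : FullGrammar α) : List (GSym α) → List α → Prop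
  | nil : Expands g [] []
  | letter (a : α) (s : List (GSym α)) (v : List α) :
      Expands g s v → Expands g (Sum.inl a :: s) (a :: v)
  | nonterminal (i : ℕ) (r s : List (GSym α)) (u v : List α) :
      g.rules[i]? = some r → Expands g r u → Expands g s v → Expands g (Sum.inr i :: s) (u ++ v)

/-- No two nonterminals have the same expansion. -/
def DistinctExpansions (g : FullGrammar α) : Prop :=
  ∀ (i j : ℕ) (v : List α), g.Expands [Sum.inr i] v → g.Expands [Sum.inr j] v → i = j

section
variable [DecidableEq α]

/-- Substitute the word `w` for every occurrence of the symbol `x` in `s`. -/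
def unfold (x : GSym α) (w s : List (GSym α)) : List (GSym α) :=
  s.flatMap (fun y => if y = x then w else [y])

/-- `g'` arises from `g` by replacing at least two pairwise non-overlapping occurrences, in the
starting string and the right-hand sides of the rules, of a word `w` of length at least `2` by a
fresh nonterminal `X`, and by adding the rule `X → w`. (Replacing some non-overlapping occurrences
of `w` by `X` is the inverse of substituting `w` for `X`.) -/
def IsReplacement (g : FullGrammar α) (w : List (GSym α)) (g' : FullGrammar α) : Prop :=
  2 ≤ w.length ∧
  ∃ (start' : List (GSym α)) (rules' : List (List (GSym α))),
    unfold g.freshSym w start' = g.start ∧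
    rules'.map (unfold g.freshSym w) = g.rules ∧
    2 ≤ (start' ++ rules'.flatten).count g.freshSym ∧
    g' = ⟨start', rules' ++ [w]⟩

/-- One round of Greedy: a replacement whose result is of the smallest possible size.
Ties are broken arbitrarily. -/
def GreedyStep (g g' : FullGrammar α) : Prop :=
  (∃ w, g.IsReplacement w g') ∧
    ∀ (w₂ : List (GSym α)) (g₂ : FullGrammar α), g.IsReplacement w₂ g₂ → g'.size ≤ g₂.size

/-- A round of Greedy in which the replaced occurrences are chosen from left to right in the
starting string and in each right-hand side. -/
def LeftGreedyStep (g g' : FullGrammar α) : Prop :=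
  GreedyStep g g' ∧ ∃ w : List (GSym α),
    g' = ⟨replaceLeft w g.freshSym g.start,
      g.rules.map (replaceLeft w g.freshSym) ++ [w]⟩

/-- No word of length at least `2` has two non-overlapping occurrences, so Greedy stops. -/
def Terminal (g : FullGrammar α) : Prop :=
  ∀ (w : List (GSym α)) (g' : FullGrammar α), ¬ g.IsReplacement w g'

/-- `g` is a full grammar that Greedy may produce (at the end of its run) on the string `S`. -/
def GreedyOutput (S : List α) (g : FullGrammar α) : Prop :=
  Relation.ReflTransGen GreedyStep (ofString S) g ∧ g.Terminal

/-- `g` is a full grammar that Greedy with left-to-right replacement may produce on `S`. -/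
def LeftGreedyOutput (S : List α) (g : FullGrammar α) : Prop :=
  Relation.ReflTransGen LeftGreedyStep (ofString S) g ∧ g.Terminal

/-- The size in bits of the entropy encoding of a full grammar: the concatenation `w` of its
right-hand sides is given to an entropy coder, which spends `|w| H₀(w) + c |w|` bits (the constant
`c` is the overhead of the coder per symbol), and the lengths of the right-hand sides
of the nonterminals are stored in unary. -/
def entropyBits (c : ℝ) (g : FullGrammar α) : ℝ :=
  (g.rhs.length : ℝ) * empEntropy 0 g.rhs + c * (g.rhs.length : ℝ) +
    ((g.rules.map (fun r => r.length + 1)).sum : ℕ)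

end

end FullGrammar

end

/-! Write n = |S| and L = log n. The constant 3/2 is 1 + 1/2: coding the final concatenation takes
at most n H_k + r log r bits up to small terms, where r is the number of rules (`rhs_entropy_le`),
and r log r is essentially at most n H_k / 2.

Both parts compare a grammar with a parsing of S. Replacing every nonterminal by its right-hand side
at exactly one occurrence yields a parsing of S by symbols with distinct expansions; it lacks r
symbols of the grammar and creates at most 2r new neighbouring pairs (`exists_unroll`). A phrase
gets a weight: its first k letters are uniform, the later ones follow the empirical contexts of S,
and a polynomial factor in the length makes the weights sum to at most one
(`sum_phraseWeight_le_one`). A parsing into m phrases then costs at most n H_k + m (k log σ + 3 log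
B) + 12 n / B bits (`sum_phraseCost_le`), used with B = L. Gibbs' inequality (`gibbs_multiset`)
bounds the empirical entropy of the phrases by this cost.

For the bound on r, stop at the first grammar g₁ of the run in which no replacement saves more than
about L² (`exists_threshold`). It has at most n / L² rules, and each pair of neighbouring symbols is
rare in it, since replacing a frequent pair would save more (`count_adj_le`). Cut the parsing of S
given by g₁ into K pairs. Their multiplicities are O(L²), so Gibbs' inequality gives K L ≤ n H_k +
small terms (`pair_entropy_le`), while |g₁| is about 2K. At most |g₁|/4 rounds follow
(`four_mul_rounds_le`), so r L is at most about K L / 2, which is n H_k / 2 up to small terms.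

Greediness enters through `exists_threshold` and through `Invariant`: right-hand sides keep length
at least two and nonterminals stay in use at least twice. Distinctness of expansions is either
assumed or deduced from left-to-right replacement (`IsParsing`). -/

/-! ### Inequalities for probability weights -/

open Finset Real in
/-- Gibbs' inequality. -/
theorem gibbs_multiset {β : Type*} [DecidableEq β] (x : Multiset β) (q : β → ℝ)
    (hq : ∀ b ∈ x, 0 < q b) (hs : ∑ b ∈ x.toFinset, q b ≤ 1) :
    ∑ b ∈ x.toFinset, (x.count b : ℝ) * logb 2 (x.card / x.count b) ≤
      (x.map fun b => -logb 2 (q b)).sum := by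
  rw [Finset.sum_multiset_map_count]
  -- This is log t ≤ t - 1 at t = |x| q(b) / count(b). The correction terms sum to |x| (∑ q - 1) /
  -- log 2, which is not positive.
  have key : ∀ b ∈ x.toFinset, (x.count b : ℝ) * logb 2 (x.card / x.count b) ≤
      x.count b • (-logb 2 (q b)) + (x.card * q b - x.count b) / log 2 := by
    intro b hb
    have hb' : b ∈ x := Multiset.mem_toFinset.1 hb
    have hc : (0 : ℝ) < x.count b := by exact_mod_cast Multiset.count_pos.2 hb'
    have hn : (0 : ℝ) < x.card := by exact_mod_cast Multiset.card_pos_iff_exists_mem.2 ⟨b, hb'⟩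
    have h2 : (0 : ℝ) < log 2 := log_pos (by norm_num)
    have hqb := hq b hb'
    have h1 : log (x.card * q b / x.count b) ≤ x.card * q b / x.count b - 1 :=
      log_le_sub_one_of_pos (by positivity)
    have h3 : log (x.card * q b / x.count b) = log (x.card / x.count b) + log (q b) := by
      rw [← log_mul (by positivity) (by positivity)]; congr 1; ring
    rw [h3] at h1
    rw [nsmul_eq_mul]
    unfold logb
    rw [← sub_nonneg]
    have : (x.count b : ℝ) * -(log (q b) / log 2) + (x.card * q b - x.count b) / log 2
        - x.count b * (log (x.card / x.count b) / log 2)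
        = x.count b / log 2 * ((x.card * q b / x.count b - 1)
          - (log (x.card / x.count b) + log (q b))) := by
      field_simp; ring
    rw [this]
    exact mul_nonneg (by positivity) (by linarith)
  refine (Finset.sum_le_sum key).trans ?_
  rw [Finset.sum_add_distrib, ← Finset.sum_div, Finset.sum_sub_distrib, ← Finset.mul_sum]
  have hcard : ∑ b ∈ x.toFinset, (x.count b : ℝ) = x.card := by
    exact_mod_cast Multiset.toFinset_sum_count_eq x
  rw [hcard]
  have h2 : (0 : ℝ) < log 2 := log_pos (by norm_num)
  have : ((x.card : ℝ) * ∑ b ∈ x.toFinset, q b - x.card) / log 2 ≤ 0 := by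
    apply div_nonpos_of_nonpos_of_nonneg _ h2.le
    nlinarith [(Nat.cast_nonneg x.card : (0 : ℝ) ≤ x.card)]
  linarith

-- The sum telescopes. These are the weights by which the phrase model distributes its mass over the
-- possible phrase lengths.
open Finset in
theorem sum_one_div_mul_succ_le_one (T : Finset ℕ) (hT : ∀ l ∈ T, 1 ≤ l) :
    ∑ l ∈ T, (1 : ℝ) / (l * (l + 1)) ≤ 1 := by
  have h1 : ∀ N : ℕ, ∑ l ∈ Finset.Ico 1 (N + 1), (1 : ℝ) / (l * (l + 1)) = 1 - 1 / (N + 1) := by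
    intro N
    induction N with
    | zero => simp
    | succ N ih =>
      rw [Finset.sum_Ico_succ_top (by omega), ih]
      push_cast
      field_simp
      ring
  refine (Finset.sum_le_sum_of_subset_of_nonneg (t := Finset.Ico 1 (T.sup id + 1)) ?_ ?_).trans ?_
  · intro l hl
    have := Finset.le_sup (f := id) hl
    simp only [id] at this
    exact Finset.mem_Ico.2 ⟨hT l hl, by omega⟩
  · intros; positivity
  · rw [h1]
    have : (0 : ℝ) ≤ 1 / (((T.sup id : ℕ) : ℝ) + 1) := by positivity
    linarith

/-! ### Counting occurrences; empirical entropy as a sum of context costs -/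

section Occurrences

variable {α : Type} [DecidableEq α]

theorem occ_eq_sum (w v : List α) :
    occ w v = ∑ i ∈ Finset.range w.length, if v <+: w.drop i then 1 else 0 := by
  unfold occ
  rw [← Finset.card_filter, List.countP_eq_length_filter, Finset.card_def]
  rfl

theorem occ_nil (w : List α) : occ w [] = w.length := by
  rw [occ_eq_sum]; simp

theorem occ_mono_prefix (w : List α) {u v : List α} (h : u <+: v) : occ w v ≤ occ w u := by
  rw [occ_eq_sum, occ_eq_sum]
  refine Finset.sum_le_sum fun i _ => ?_
  split_ifs with h1 h2 <;> simp
  exact h2 (h.trans h1)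

/-- Each occurrence of `v` is followed by at most one letter; an occurrence at the very end of `w`
is followed by none, hence only an inequality. -/
theorem sum_occ_concat_le [Fintype α] (w v : List α) : ∑ a, occ w (v ++ [a]) ≤ occ w v := by
  simp only [occ_eq_sum]
  rw [Finset.sum_comm]
  refine Finset.sum_le_sum fun i _ => ?_
  by_cases h : v <+: w.drop i
  · rw [if_pos h]
    obtain ⟨t, ht⟩ := h
    rw [← ht]
    simp only [List.prefix_append_right_inj]
    cases t with
    | nil => simp
    | cons b t =>
      simp [List.cons_prefix_cons]
  · rw [if_neg h]
    refine le_of_eq (Finset.sum_eq_zero fun a _ => if_neg fun h' => h ?_)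
    exact (List.prefix_append v [a]).trans h'

theorem occ_pos_of_infix {w v : List α} (hw : w ≠ []) (h : v <:+: w) : 0 < occ w v := by
  rcases eq_or_ne v [] with rfl | hv
  · rw [occ_nil]; exact List.length_pos_of_ne_nil hw
  obtain ⟨A, B, rfl⟩ := h
  rw [occ_eq_sum]
  refine Finset.sum_pos' (fun _ _ => Nat.zero_le _) ⟨A.length, ?_, ?_⟩
  · have := List.length_pos_of_ne_nil hv
    simp; omega
  · simp

theorem occ_singleton (w : List α) (a : α) : occ w [a] = w.count a := by
  rw [occ_eq_sum]
  induction w with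
  | nil => simp
  | cons b w ih =>
    rw [List.length_cons, Finset.sum_range_succ', List.count_cons, ← ih]
    by_cases h : a = b
    · simp [List.cons_prefix_cons, h]
    · simp [List.cons_prefix_cons, h, Ne.symm h]

/-- The factors of length `m` of `w`, listed by their positions. -/
def factors (m : ℕ) : List α → List (List α)
  | [] => []
  | a :: w => if m ≤ (a :: w).length then (a :: w).take m :: factors m w else factors m w

theorem count_factors (m : ℕ) (u w : List α) (hu : u.length = m) :
    (factors m w).count u = occ w u := by
  rw [occ_eq_sum]
  induction w with
  | nil => simp [factors]
  | cons b w ih =>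
    rw [List.length_cons, Finset.sum_range_succ']
    simp only [List.drop_succ_cons, List.drop_zero]
    rw [← ih, factors]
    split_ifs with h1 h2 h2
    · rw [List.count_cons, if_pos]
      rw [List.prefix_iff_eq_take, hu] at h2
      simp [← h2]
    · rw [List.count_cons, if_neg]
      · intro h
        apply h2
        simp only [beq_iff_eq] at h
        rw [← h]
        exact List.take_prefix _ _
    · exact absurd (h2.length_le) (by omega)
    · rfl

theorem toFinset_factors (m : ℕ) (w : List α) :
    (factors m w).toFinset = subwords m w := by
  ext u
  rw [List.mem_toFinset]
  unfold subwords
  simp only [Finset.mem_filter, List.mem_toFinset, List.mem_map, List.mem_range]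
  induction w with
  | nil => simp [factors]
  | cons b w ih =>
    rw [factors]
    constructor
    · intro h
      split_ifs at h with h1
      · rcases List.mem_cons.1 h with rfl | h
        · exact ⟨⟨0, by simp, rfl⟩, by rw [List.length_take]; omega⟩
        · obtain ⟨⟨i, hi, h2⟩, h3⟩ := ih.1 h
          exact ⟨⟨i + 1, by simpa using hi, h2⟩, h3⟩
      · obtain ⟨⟨i, hi, h2⟩, h3⟩ := ih.1 h
        exact ⟨⟨i + 1, by simpa using hi, h2⟩, h3⟩
    · rintro ⟨⟨i, hi, h2⟩, h3⟩
      cases i with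
      | zero =>
        simp only [List.drop_zero] at h2
        have : m ≤ (b :: w).length := by
          rw [← h2, List.length_take] at h3; omega
        rw [if_pos this, h2]; exact List.mem_cons_self
      | succ i =>
        have := ih.2 ⟨⟨i, by simpa using hi, h2⟩, h3⟩
        split_ifs
        · exact List.mem_cons_of_mem _ this
        · exact this

/-- The cost `log₂ (|S|_v / |S|_{va})` of the word `u = va`. -/
noncomputable def ctxCost (S u : List α) : ℝ := Real.logb 2 ((occ S u.dropLast : ℝ) / (occ S u : ℝ))

theorem ctxCost_nonneg (S u : List α) : 0 ≤ ctxCost S u := by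
  unfold ctxCost
  rcases Nat.eq_zero_or_pos (occ S u) with h | h
  · simp [h]
  · apply Real.logb_nonneg (by norm_num)
    rw [one_le_div (by exact_mod_cast h)]
    exact_mod_cast occ_mono_prefix S (List.dropLast_prefix u)

/-- The total cost of all positions of `w` that are preceded by `k` letters of `w`. -/
noncomputable def totalCost (k : ℕ) (S w : List α) : ℝ := ((factors (k + 1) w).map (ctxCost S)).sum

theorem totalCost_nonneg (k : ℕ) (S w : List α) : 0 ≤ totalCost k S w :=
  List.sum_nonneg fun x hx => by
    obtain ⟨u, _, rfl⟩ := List.mem_map.1 hx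
    exact ctxCost_nonneg S u

/-- Group the positions of `S` by the window of length `k + 1` that starts there. -/
theorem length_mul_empEntropy (k : ℕ) (S : List α) :
    (S.length : ℝ) * empEntropy k S = totalCost k S S := by
  unfold empEntropy totalCost
  rw [Finset.sum_list_map_count, toFinset_factors (k + 1)]
  rcases eq_or_ne S [] with rfl | hS
  · simp [subwords]
  have hn : (S.length : ℝ) ≠ 0 := by
    exact_mod_cast (List.length_pos_of_ne_nil hS).ne'
  rw [← mul_assoc, mul_neg, mul_one_div_cancel hn, neg_one_mul, ← Finset.sum_neg_distrib]
  refine Finset.sum_congr rfl fun u hu => ?_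
  have hu' : u.length = k + 1 := (Finset.mem_filter.1 hu).2
  rw [nsmul_eq_mul, ctxCost, ← mul_neg, ← Real.logb_inv, inv_div, ← count_factors _ u S hu']
  congr!

/-- The windows of `u` and of `v` are windows of `u ++ v`; those that cross the border only add
nonnegative costs. This is why cutting `S` into phrases does not exceed n H_k, apart from the phrase
beginnings. -/
theorem totalCost_append_le (k : ℕ) (S u v : List α) :
    totalCost k S u + totalCost k S v ≤ totalCost k S (u ++ v) := by
  induction u with
  | nil => simp [totalCost, factors]
  | cons a u ih =>
    unfold totalCost at ih ⊢
    rw [List.cons_append, factors, factors]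
    by_cases h : k + 1 ≤ (a :: u).length
    · rw [if_pos h, if_pos (by simp at h ⊢; omega), List.map_cons, List.map_cons, List.sum_cons,
        List.sum_cons, ← List.cons_append, List.take_append_of_le_length h]
      linarith
    · rw [if_neg h]
      split_ifs
      · rw [List.map_cons, List.sum_cons]
        have := ctxCost_nonneg S ((a :: (u ++ v)).take (k + 1))
        linarith
      · exact ih

theorem length_mul_empEntropy_zero (w : List α) :
    (w.length : ℝ) * empEntropy 0 w =
      ∑ b ∈ (w : Multiset α).toFinset, ((w : Multiset α).count b : ℝ) *
        Real.logb 2 ((w : Multiset α).card / (w : Multiset α).count b) := by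
  rw [length_mul_empEntropy, totalCost]
  have h : factors 1 w = w.map fun a => [a] := by
    induction w with
    | nil => rfl
    | cons a w ih => simp [factors, ih]
  rw [zero_add, h, List.map_map, Finset.sum_list_map_count]
  refine Finset.sum_congr rfl fun b _ => ?_
  simp [ctxCost, occ_nil, occ_singleton]

end Occurrences

/-! ### The phrase model -/

section PhraseModel

variable {α : Type} [DecidableEq α] [Fintype α]

/-- The probability of the letter `a` after the context `v`, in the model that uses the empirical
distribution of `S` in contexts of length `k`, and the uniform distribution in shorter contexts. -/
noncomputable def ctxProb (k : ℕ) (S v : List α) (a : α) : ℝ :=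
  if v.length < k then 1 / (Fintype.card α : ℝ) else (occ S (v ++ [a]) : ℝ) / (occ S v : ℝ)

/-- The probability of the word that follows the context `v`. -/
noncomputable def strProb (k : ℕ) (S : List α) : List α → List α → ℝ
  | _, [] => 1
  | v, a :: e => ctxProb k S v a *
      strProb k S (if v.length < k then v ++ [a] else (v ++ [a]).tail) e

theorem ctxProb_nonneg (k : ℕ) (S v : List α) (a : α) : 0 ≤ ctxProb k S v a := by
  unfold ctxProb; split_ifs <;> positivity

theorem sum_ctxProb_le_one (k : ℕ) (S v : List α) : ∑ a, ctxProb k S v a ≤ 1 := by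
  unfold ctxProb
  split_ifs
  · rw [Finset.sum_const, nsmul_eq_mul, Finset.card_univ]
    rw [mul_one_div]; exact div_self_le_one _
  · rw [← Finset.sum_div]
    apply div_le_one_of_le₀ _ (by positivity)
    exact_mod_cast sum_occ_concat_le S v

theorem ctxProb_le_one (k : ℕ) (S v : List α) (a : α) : ctxProb k S v a ≤ 1 :=
  (Finset.single_le_sum (fun b _ => ctxProb_nonneg k S v b) (Finset.mem_univ a)).trans
    (sum_ctxProb_le_one k S v)

theorem strProb_nonneg (k : ℕ) (S v e : List α) : 0 ≤ strProb k S v e := by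
  induction e generalizing v with
  | nil => simp [strProb]
  | cons a e ih => exact mul_nonneg (ctxProb_nonneg _ _ _ _) (ih _)

theorem strProb_le_one (k : ℕ) (S v e : List α) : strProb k S v e ≤ 1 := by
  induction e generalizing v with
  | nil => simp [strProb]
  | cons a e ih => exact mul_le_one₀ (ctxProb_le_one _ _ _ _) (strProb_nonneg _ _ _ _) (ih _)

/-- Induction on the length: split off the first letter and apply the hypothesis in the context that
this letter produces. -/
theorem sum_strProb_le_one (k : ℕ) (S : List α) (l : ℕ) (v : List α) (T : Finset (List α))
    (hT : ∀ e ∈ T, e.length = l) : ∑ e ∈ T, strProb k S v e ≤ 1 := by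
  induction l generalizing v T with
  | zero =>
    have : T ⊆ {[]} := fun e he => by simpa using hT e he
    refine (Finset.sum_le_sum_of_subset_of_nonneg this
      fun e _ _ => strProb_nonneg k S v e).trans ?_
    simp [strProb]
  | succ l ih =>
    have hsub : T ⊆ ((Finset.univ : Finset α) ×ˢ T.image List.tail).image
        (fun p => p.1 :: p.2) := by
      intro e he
      have h := hT e he
      match e, h with
      | a :: e, _ =>
        exact Finset.mem_image.2 ⟨(a, e), Finset.mem_product.2
          ⟨Finset.mem_univ a, Finset.mem_image.2 ⟨_, he, rfl⟩⟩, rfl⟩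
    refine (Finset.sum_le_sum_of_subset_of_nonneg hsub
      fun e _ _ => strProb_nonneg k S v e).trans ?_
    rw [Finset.sum_image (fun p _ q _ h => by
      obtain ⟨h1, h2⟩ := List.cons.inj h
      exact Prod.ext h1 h2), Finset.sum_product]
    refine le_trans (Finset.sum_le_sum fun a _ => ?_) (sum_ctxProb_le_one k S v)
    simp only [strProb]
    rw [← Finset.mul_sum]
    refine mul_le_of_le_one_right (ctxProb_nonneg _ _ _ _) (ih _ _ ?_)
    intro e he
    obtain ⟨e', he', rfl⟩ := Finset.mem_image.1 he
    rw [List.length_tail, hT e' he']; rfl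

/-- The weight of the phrase `e` in the phrase model. -/
noncomputable def phraseWeight (k : ℕ) (S e : List α) : ℝ :=
  strProb k S [] e / ((e.length : ℝ) ^ 2 * (e.length + 1))

theorem phraseWeight_nonneg (k : ℕ) (S e : List α) : 0 ≤ phraseWeight k S e :=
  div_nonneg (strProb_nonneg _ _ _ _) (by positivity)

theorem phraseWeight_le_one (k : ℕ) (S e : List α) : phraseWeight k S e ≤ 1 := by
  unfold phraseWeight
  rcases Nat.eq_zero_or_pos e.length with h | h
  · simp [h]
  · have h1 : (1 : ℝ) ≤ e.length := by exact_mod_cast h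
    apply div_le_one_of_le₀ _ (by positivity)
    refine (strProb_le_one _ _ _ _).trans ?_
    nlinarith [one_le_pow₀ h1 (n := 2)]

/-- The denominator l²(l + 1) is l · l(l + 1). One factor l pays for the at most l indices `b` that
share a phrase of length l, as `j b < l` tells them apart; the rest is the weight of the length. For
pairs of symbols `j` will be the cut position, for single symbols it is 0. -/
theorem sum_phraseWeight_le_one {β : Type*} [DecidableEq β] (k : ℕ) (S : List α) (B : Finset β)
    (e : β → List α) (j : β → ℕ) (hj : ∀ b ∈ B, j b < (e b).length)
    (hinj : ∀ b ∈ B, ∀ b' ∈ B, e b = e b' → j b = j b' → b = b') :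
    ∑ b ∈ B, phraseWeight k S (e b) ≤ 1 := by
  have hpos : ∀ x ∈ B.image e, 0 < x.length := by
    intro x hx
    obtain ⟨b, hb, rfl⟩ := Finset.mem_image.1 hx
    exact (Nat.zero_le _).trans_lt (hj b hb)
  rw [← Finset.sum_fiberwise_of_maps_to (t := B.image e)
    (fun b hb => Finset.mem_image_of_mem e hb)]
  have h1 : ∀ x ∈ B.image e, ∑ b ∈ B with e b = x, phraseWeight k S (e b) ≤
      strProb k S [] x / (x.length * (x.length + 1)) := by
    intro x hx
    have hxp : (0 : ℝ) < x.length := by exact_mod_cast hpos x hx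
    rw [Finset.sum_congr rfl (g := fun _ => phraseWeight k S x)
      (fun b hb => by rw [(Finset.mem_filter.1 hb).2]), Finset.sum_const, nsmul_eq_mul]
    have hcard : ({b ∈ B | e b = x} : Finset β).card ≤ x.length := by
      rw [← Finset.card_range x.length]
      refine Finset.card_le_card_of_injOn j ?_ ?_
      · intro b hb
        obtain ⟨hb1, hb2⟩ := Finset.mem_filter.1 hb
        simpa [hb2] using hj b hb1
      · intro b hb b' hb' h
        obtain ⟨hb1, hb2⟩ := Finset.mem_filter.1 hb
        obtain ⟨hb1', hb2'⟩ := Finset.mem_filter.1 hb'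
        exact hinj b hb1 b' hb1' (hb2.trans hb2'.symm) h
    have hcard' : ((({b ∈ B | e b = x} : Finset β).card : ℕ) : ℝ) ≤ x.length := by
      exact_mod_cast hcard
    refine (mul_le_mul_of_nonneg_right hcard' (phraseWeight_nonneg k S x)).trans (le_of_eq ?_)
    unfold phraseWeight
    field_simp
  refine (Finset.sum_le_sum h1).trans ?_
  rw [← Finset.sum_fiberwise_of_maps_to (t := (B.image e).image List.length)
    (fun x hx => Finset.mem_image_of_mem _ hx)]
  refine le_trans (Finset.sum_le_sum (g := fun l : ℕ => (1 : ℝ) / (l * (l + 1))) ?_)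
    (sum_one_div_mul_succ_le_one ((B.image e).image List.length) ?_)
  · intro l _
    rw [Finset.sum_congr rfl (g := fun x => strProb k S [] x / (l * (l + 1)))
      (fun x hx => by rw [(Finset.mem_filter.1 hx).2]), ← Finset.sum_div]
    apply div_le_div_of_nonneg_right _ (by positivity)
    exact sum_strProb_le_one k S l [] _ fun x hx => (Finset.mem_filter.1 hx).2
  · intro l hl
    obtain ⟨x, hx, rfl⟩ := Finset.mem_image.1 hl
    exact hpos x hx

/-- While the context is shorter than `k`, a letter costs log σ, and at most `k - v.length` letters
are of this kind. After that each letter costs exactly the `ctxCost` of the window that ends with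
it. Being a factor of `S` keeps all counts positive. -/
theorem strProb_pos_and_cost (k : ℕ) (S : List α) (hS : S ≠ []) (v e : List α)
    (hv : v.length ≤ k) (h : v ++ e <:+: S) :
    0 < strProb k S v e ∧ -Real.logb 2 (strProb k S v e) ≤
      ((k : ℝ) - v.length) * Real.logb 2 (Fintype.card α) + totalCost k S (v ++ e) := by
  have hcard : (1 : ℝ) ≤ Fintype.card α := by
    have : 0 < Fintype.card α := Fintype.card_pos_iff.2 ⟨S.head hS⟩
    exact_mod_cast this
  have hlog : 0 ≤ Real.logb 2 (Fintype.card α) := Real.logb_nonneg (by norm_num) hcard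
  induction e generalizing v with
  | nil =>
    have : (v.length : ℝ) ≤ k := by exact_mod_cast hv
    simp only [strProb, Real.logb_one, neg_zero, List.append_nil]
    refine ⟨one_pos, add_nonneg (mul_nonneg (by linarith) hlog) (totalCost_nonneg _ _ _)⟩
  | cons a e ih =>
    rw [strProb, ctxProb]
    split_ifs with hlt
    · obtain ⟨h1, h2⟩ := ih (v ++ [a]) (by simp; omega) (by simpa using h)
      refine ⟨by positivity, ?_⟩
      rw [Real.logb_mul (by positivity) h1.ne', one_div, Real.logb_inv]
      simp only [List.length_append, List.length_cons, List.length_nil, List.append_assoc,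
        List.cons_append, List.nil_append] at h2
      push_cast at h2
      linarith
    · have hvk : v.length = k := by omega
      have hva : v ++ [a] <:+: S := by
        refine List.IsInfix.trans ?_ h
        exact ⟨[], e, by simp⟩
      have hv' : v <:+: S := (List.prefix_append v _).isInfix.trans h
      have ho1 : 0 < occ S (v ++ [a]) := occ_pos_of_infix hS hva
      have ho2 : 0 < occ S v := occ_pos_of_infix hS hv'
      have hsplit : ∃ b, v ++ [a] = b :: (v ++ [a]).tail := by
        cases v <;> simp
      obtain ⟨b, hb⟩ := hsplit
      have hlen : (v ++ [a]).tail.length = k := by simp [hvk]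
      have hdec : v ++ a :: e = b :: ((v ++ [a]).tail ++ e) := by
        rw [← List.cons_append, ← hb]; simp
      obtain ⟨h1, h2⟩ := ih (v ++ [a]).tail hlen.le (by
        refine List.IsInfix.trans ?_ h
        rw [hdec]; exact (List.suffix_cons _ _).isInfix)
      have ho1' : (0 : ℝ) < occ S (v ++ [a]) := by exact_mod_cast ho1
      have ho2' : (0 : ℝ) < occ S v := by exact_mod_cast ho2
      refine ⟨by positivity, ?_⟩
      rw [Real.logb_mul (by positivity) h1.ne', hvk, sub_self, zero_mul, zero_add]
      rw [hlen, sub_self, zero_mul, zero_add] at h2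
      have htake : (b :: ((v ++ [a]).tail ++ e)).take (k + 1) = v ++ [a] := by
        rw [← List.cons_append, ← hb, List.take_append_of_le_length (by simp [hvk])]
        exact List.take_of_length_le (by simp [hvk])
      have htc : totalCost k S (v ++ a :: e) =
          ctxCost S (v ++ [a]) + totalCost k S ((v ++ [a]).tail ++ e) := by
        rw [hdec]
        unfold totalCost
        rw [factors, if_pos (by rw [List.length_cons, List.length_append, hlen]; omega), htake,
          List.map_cons, List.sum_cons]
      have hcc : ctxCost S (v ++ [a]) = -Real.logb 2 ((occ S (v ++ [a]) : ℝ) / occ S v) := by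
        rw [ctxCost, List.dropLast_concat, ← Real.logb_inv, inv_div]
      rw [htc, hcc]
      linarith

theorem logb_le_two_mul (x : ℝ) (hx : 0 < x) : Real.logb 2 x ≤ 2 * x := by
  unfold Real.logb
  have h2 := Real.log_two_gt_d9
  rw [div_le_iff₀ (by linarith)]
  nlinarith [Real.log_le_sub_one_of_pos hx]

/-- A substitute for concavity of the logarithm: summed over phrase lengths with total n, it gives
log B per phrase plus O(n / B), without reference to the average length. -/
theorem logb_le_logb_add_div (x B : ℝ) (hx : 0 < x) (hB : 0 < B) :
    Real.logb 2 x ≤ Real.logb 2 B + 2 * x / B := by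
  have h := logb_le_two_mul (x / B) (by positivity)
  rw [Real.logb_div hx.ne' hB.ne'] at h
  have : 2 * (x / B) = 2 * x / B := by ring
  linarith

theorem phraseWeight_pos_and_cost (k : ℕ) (S : List α) (e : List α) (he : e ≠ []) (h : e <:+: S)
    (B : ℝ) (hB : 0 < B) :
    0 < phraseWeight k S e ∧ -Real.logb 2 (phraseWeight k S e) ≤
      (k : ℝ) * Real.logb 2 (Fintype.card α) + 3 * Real.logb 2 B + totalCost k S e +
        12 * e.length / B := by
  have hS : S ≠ [] := by rintro rfl; exact he (List.infix_nil.1 h)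
  obtain ⟨h1, h2⟩ := strProb_pos_and_cost k S hS [] e (Nat.zero_le _) (by simpa using h)
  have hl : (1 : ℝ) ≤ e.length := by exact_mod_cast List.length_pos_of_ne_nil he
  have hl0 : (0 : ℝ) < e.length := by linarith
  refine ⟨by unfold phraseWeight; positivity, ?_⟩
  unfold phraseWeight
  rw [Real.logb_div h1.ne' (by positivity), Real.logb_mul (by positivity) (by positivity),
    Real.logb_pow]
  simp only [List.length_nil, Nat.cast_zero, sub_zero, List.nil_append] at h2
  have h3 : Real.logb 2 (e.length : ℝ) ≤ Real.logb 2 ((e.length : ℝ) + 1) :=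
    Real.logb_le_logb_of_le (by norm_num) hl0 (by linarith)
  have h4 := logb_le_logb_add_div ((e.length : ℝ) + 1) B (by linarith) hB
  have h5 : 2 * ((e.length : ℝ) + 1) / B ≤ 4 * e.length / B := by
    apply div_le_div_of_nonneg_right _ hB.le; linarith
  have h6 : 12 * (e.length : ℝ) / B = 3 * (4 * e.length / B) := by ring
  push_cast
  linarith

theorem sum_phraseCost_le (k : ℕ) (S : List α) (L : List (List α)) (hL : ∀ e ∈ L, e ≠ [])
    (hflat : L.flatten = S) (B : ℝ) (hB : 0 < B) :
    (L.map fun e => -Real.logb 2 (phraseWeight k S e)).sum ≤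
      (S.length : ℝ) * empEntropy k S + L.length * ((k : ℝ) * Real.logb 2 (Fintype.card α) +
        3 * Real.logb 2 B) + 12 * S.length / B := by
  -- For the induction over the phrases, the parsed word is allowed to be a factor of `S`, while the
  -- costs still refer to the contexts of `S`.
  have key : ∀ L' : List (List α), (∀ e ∈ L', e ≠ []) → L'.flatten <:+: S →
      (L'.map fun e => -Real.logb 2 (phraseWeight k S e)).sum ≤
      totalCost k S L'.flatten + L'.length * ((k : ℝ) * Real.logb 2 (Fintype.card α) +
        3 * Real.logb 2 B) + 12 * L'.flatten.length / B := by
    intro L'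
    induction L' with
    | nil => intro _ _; simp [totalCost_nonneg]
    | cons e L' ih =>
      intro h1 h2
      rw [List.flatten_cons] at h2
      have h3 := ih (fun x hx => h1 x (List.mem_cons_of_mem _ hx))
        ((List.suffix_append _ _).isInfix.trans h2)
      have h4 := (phraseWeight_pos_and_cost k S e (h1 e List.mem_cons_self)
        ((List.prefix_append _ _).isInfix.trans h2) B hB).2
      have h5 := totalCost_append_le k S e L'.flatten
      rw [List.map_cons, List.sum_cons, List.flatten_cons, List.length_append, List.length_cons]
      push_cast
      have h6 : 12 * ((e.length : ℝ) + L'.flatten.length) / B =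
        12 * e.length / B + 12 * L'.flatten.length / B := by ring
      rw [h6]
      linarith
  have := key L hL (by rw [hflat])
  rw [hflat, ← length_mul_empEntropy] at this
  exact this

end PhraseModel

/-! ### Substituting a word for a symbol -/

namespace FullGrammar

instance lawfulBEq_gsym {α : Type} [DecidableEq α] : LawfulBEq (GSym α) where
  eq_of_beq {a b} h := by
    change Sum.instBEq.beq a b = true at h
    cases a <;> cases b <;> simp [Sum.instBEq.beq] at h <;> rw [h]
  rfl {a} := by
    change Sum.instBEq.beq a a = true
    cases a <;> simp [Sum.instBEq.beq]

theorem count_coe_gsym {α : Type} [DecidableEq α] (x : GSym α) (l : List (GSym α)) :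
    (l : Multiset (GSym α)).count x = l.count x := by
  rw [Multiset.coe_count]; congr!

section Unfold

variable {α : Type} [DecidableEq α]

theorem unfold_nil (x : GSym α) (w : List (GSym α)) : FullGrammar.unfold x w [] = [] := rfl

theorem unfold_cons_self (x : GSym α) (w s : List (GSym α)) :
    FullGrammar.unfold x w (x :: s) = w ++ FullGrammar.unfold x w s := by
  simp [FullGrammar.unfold]

theorem unfold_cons_of_ne {x y : GSym α} (h : y ≠ x) (w s : List (GSym α)) :
    FullGrammar.unfold x w (y :: s) = y :: FullGrammar.unfold x w s := by
  simp [FullGrammar.unfold, h]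

theorem unfold_append (x : GSym α) (w s t : List (GSym α)) :
    FullGrammar.unfold x w (s ++ t) = FullGrammar.unfold x w s ++ FullGrammar.unfold x w t := by
  simp [FullGrammar.unfold]

theorem unfold_of_notMem {x : GSym α} {s : List (GSym α)} (h : x ∉ s) (w : List (GSym α)) :
    FullGrammar.unfold x w s = s := by
  induction s with
  | nil => rfl
  | cons y s ih =>
    rw [List.mem_cons, not_or] at h
    rw [unfold_cons_of_ne (Ne.symm h.1), ih h.2]

theorem unfold_reverse (x : GSym α) (w s : List (GSym α)) :
    FullGrammar.unfold x w.reverse s.reverse = (FullGrammar.unfold x w s).reverse := by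
  induction s with
  | nil => rfl
  | cons y s ih =>
    rw [List.reverse_cons, unfold_append, ih]
    by_cases h : y = x
    · subst h; rw [unfold_cons_self, unfold_cons_self]; simp [unfold_nil]
    · rw [unfold_cons_of_ne h, unfold_cons_of_ne h]; simp [unfold_nil]

theorem count_unfold {x y : GSym α} (h : y ≠ x) (w s : List (GSym α)) :
    (FullGrammar.unfold x w s).count y = s.count y + s.count x * w.count y := by
  induction s with
  | nil => simp [unfold_nil]
  | cons z s ih =>
    by_cases hz : z = x
    · subst hz
      rw [unfold_cons_self, List.count_append, ih, List.count_cons_self,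
        List.count_cons_of_ne (Ne.symm h)]
      ring
    · rw [unfold_cons_of_ne hz, List.count_cons, List.count_cons, ih, List.count_cons_of_ne hz]
      ring

theorem length_unfold (x : GSym α) (w s : List (GSym α)) :
    (FullGrammar.unfold x w s).length + s.count x = s.length + s.count x * w.length := by
  induction s with
  | nil => simp [unfold_nil]
  | cons z s ih =>
    by_cases hz : z = x
    · subst hz
      rw [unfold_cons_self, List.length_append, List.count_cons_self, List.length_cons]
      linarith
    · rw [unfold_cons_of_ne hz, List.count_cons_of_ne hz, List.length_cons, List.length_cons]
      linarith

theorem unfold_infix {s t : List (GSym α)} (h : s <:+: t) (x : GSym α) (w : List (GSym α)) :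
    FullGrammar.unfold x w s <:+: FullGrammar.unfold x w t := by
  obtain ⟨A, B, rfl⟩ := h
  exact ⟨FullGrammar.unfold x w A, FullGrammar.unfold x w B, by simp [unfold_append]⟩

theorem infix_unfold_of_mem {x : GSym α} {s : List (GSym α)} (h : x ∈ s) (w : List (GSym α)) :
    w <:+: FullGrammar.unfold x w s := by
  obtain ⟨A, B, rfl⟩ := List.append_of_mem h
  exact ⟨FullGrammar.unfold x w A, FullGrammar.unfold x w B, by
    rw [unfold_append, unfold_cons_self, List.append_assoc]⟩

theorem flatMap_unfold {β : Type*} (f : GSym α → List β) (x : GSym α) (w s : List (GSym α))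
    (h : f x = w.flatMap f) : (FullGrammar.unfold x w s).flatMap f = s.flatMap f := by
  induction s with
  | nil => rfl
  | cons y s ih =>
    by_cases hy : y = x
    · subst hy; rw [unfold_cons_self, List.flatMap_append, ih, List.flatMap_cons, h]
    · rw [unfold_cons_of_ne hy, List.flatMap_cons, List.flatMap_cons, ih]

/-- Where an occurrence of a symbol of an unfolded word comes from. -/
theorem unfold_eq_append_cons {x y : GSym α} {w s A B : List (GSym α)}
    (h : FullGrammar.unfold x w s = A ++ y :: B) :
    (∃ A' B', s = A' ++ y :: B' ∧ FullGrammar.unfold x w A' = A ∧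
      FullGrammar.unfold x w B' = B) ∨
    (∃ A' B' w₁ w₂, s = A' ++ x :: B' ∧ w = w₁ ++ y :: w₂ ∧
      FullGrammar.unfold x w A' ++ w₁ = A ∧ w₂ ++ FullGrammar.unfold x w B' = B) := by
  induction s generalizing A with
  | nil => simp [unfold_nil] at h
  | cons z s ih =>
    by_cases hz : z = x
    · subst hz
      rw [unfold_cons_self] at h
      rcases List.append_eq_append_iff.1 h with ⟨C, h1, h2⟩ | ⟨C, h1, h2⟩
      · rcases ih h2 with ⟨A', B', rfl, h3, h4⟩ | ⟨A', B', w₁, w₂, rfl, h3, h4, h5⟩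
        · exact Or.inl ⟨z :: A', B', rfl, by rw [unfold_cons_self, h3, h1], h4⟩
        · exact Or.inr ⟨z :: A', B', w₁, w₂, rfl, h3, by
            rw [unfold_cons_self, List.append_assoc, h4, h1], h5⟩
      · cases C with
        | nil =>
          simp only [List.append_nil, List.nil_append] at h1 h2
          rcases ih (A := []) h2.symm with ⟨A', B', rfl, h3, h4⟩ | ⟨A', B', w₁, w₂, rfl, h3, h4, h5⟩
          · exact Or.inl ⟨z :: A', B', rfl, by rw [unfold_cons_self, h3, h1, List.append_nil], h4⟩
          · exact Or.inr ⟨z :: A', B', w₁, w₂, rfl, h3, by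
              rw [unfold_cons_self, List.append_assoc, h4, h1, List.append_nil], h5⟩
        | cons c C =>
          obtain ⟨rfl, h3⟩ := List.cons.inj h2
          exact Or.inr ⟨[], s, A, C, rfl, h1, rfl, h3.symm⟩
    · rw [unfold_cons_of_ne hz] at h
      cases A with
      | nil =>
        obtain ⟨rfl, h3⟩ := List.cons.inj h
        exact Or.inl ⟨[], s, rfl, rfl, h3⟩
      | cons a A =>
        obtain ⟨rfl, h3⟩ := List.cons.inj h
        rcases ih h3 with ⟨A', B', rfl, h3, h4⟩ | ⟨A', B', w₁, w₂, rfl, h3, h4, h5⟩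
        · exact Or.inl ⟨z :: A', B', rfl, by rw [unfold_cons_of_ne hz, h3], h4⟩
        · exact Or.inr ⟨z :: A', B', w₁, w₂, rfl, h3, by
            rw [unfold_cons_of_ne hz, List.cons_append, h4], h5⟩

end Unfold

/-! ### Grammars as numbered strings; replacements and their sizes -/

section Strings

variable {α : Type}

/-- The strings of a full grammar: `str g 0` is the starting string, and `str g (i + 1)` is the
right-hand side of the nonterminal `i`. -/
def str (g : FullGrammar α) : ℕ → List (GSym α)
  | 0 => g.start
  | i + 1 => g.rules.getD i []

/-- The full grammar with `r` rules and the given strings. -/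
def ofStrings (f : ℕ → List (GSym α)) (r : ℕ) : FullGrammar α :=
  ⟨f 0, (List.range r).map fun i => f (i + 1)⟩

theorem length_rules_ofStrings (f : ℕ → List (GSym α)) (r : ℕ) :
    (ofStrings f r).rules.length = r := by simp [ofStrings]

theorem str_ofStrings (f : ℕ → List (GSym α)) {r j : ℕ} (hj : j ≤ r) :
    str (ofStrings f r) j = f j := by
  cases j with
  | zero => rfl
  | succ i =>
    have : i < r := hj
    simp [str, ofStrings, this]

theorem coe_rhs (g : FullGrammar α) : (g.rhs : Multiset (GSym α)) =
    ∑ j ∈ Finset.range (g.rules.length + 1), (g.str j : Multiset (GSym α)) := by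
  have key : ∀ l : List (List (GSym α)), (l.flatten : Multiset (GSym α)) =
      ∑ i ∈ Finset.range l.length, ((l.getD i [] : List (GSym α)) : Multiset (GSym α)) := by
    intro l
    induction l with
    | nil => rfl
    | cons a l ih =>
      rw [List.length_cons, Finset.sum_range_succ', List.flatten_cons, ← Multiset.coe_add, ih,
        add_comm]
      rfl
  rw [Finset.sum_range_succ', rhs, ← Multiset.coe_add, key, add_comm]
  rfl

theorem size_eq_sum (g : FullGrammar α) :
    g.size = ∑ j ∈ Finset.range (g.rules.length + 1), (g.str j).length := by
  rw [size, ← Multiset.coe_card, coe_rhs, Multiset.card_sum]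
  rfl

theorem count_rhs [DecidableEq α] (g : FullGrammar α) (x : GSym α) : g.rhs.count x =
    ∑ j ∈ Finset.range (g.rules.length + 1), (g.str j).count x := by
  rw [← count_coe_gsym, coe_rhs, Multiset.count_sum']
  exact Finset.sum_congr rfl fun j _ => count_coe_gsym x _

theorem mem_rhs_iff (g : FullGrammar α) (x : GSym α) :
    x ∈ g.rhs ↔ ∃ j ≤ g.rules.length, x ∈ g.str j := by
  rw [← Multiset.mem_coe, coe_rhs, Multiset.mem_sum]
  simp

end Strings

section Replacement

variable {α : Type} [DecidableEq α]

/-- A replacement, in terms of the numbered strings of the two grammars. -/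
structure Rep (g : FullGrammar α) (w : List (GSym α)) (g' : FullGrammar α) : Prop where
  two_le : 2 ≤ w.length
  length_rules : g'.rules.length = g.rules.length + 1
  unfold_str : ∀ j ≤ g.rules.length, FullGrammar.unfold g.freshSym w (g'.str j) = g.str j
  str_last : g'.str (g.rules.length + 1) = w
  two_le_count : 2 ≤ ∑ j ∈ Finset.range (g.rules.length + 1), (g'.str j).count g.freshSym

theorem isReplacement_iff_rep (g : FullGrammar α) (w : List (GSym α)) (g' : FullGrammar α) :
    g.IsReplacement w g' ↔ Rep g w g' := by
  constructor
  · rintro ⟨hw, start', rules', h1, h2, h3, rfl⟩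
    have hlen : rules'.length = g.rules.length := by rw [← h2]; simp
    have hstr : ∀ j ≤ g.rules.length,
        str ⟨start', rules' ++ [w]⟩ j = str ⟨start', rules'⟩ j := by
      intro j hj
      cases j with
      | zero => rfl
      | succ i =>
        simp only [str]
        rw [List.getD_append _ _ _ _ (by omega)]
    refine ⟨hw, by simp [hlen], ?_, ?_, ?_⟩
    · intro j hj
      rw [hstr j hj]
      cases j with
      | zero => exact h1
      | succ i =>
        have hi : i < rules'.length := by omega
        simp only [str]
        rw [← h2]
        simp [hi]
    · simp only [str]
      rw [← hlen]; simp
    · refine h3.trans (le_of_eq ?_)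
      have := count_rhs ⟨start', rules'⟩ g.freshSym
      simp only [rhs, hlen] at this
      rw [this]
      exact Finset.sum_congr rfl fun j hj => by
        rw [hstr j (Nat.lt_succ_iff.1 (Finset.mem_range.1 hj))]
  · intro h
    refine ⟨h.two_le, g'.start, g'.rules.take g.rules.length, h.unfold_str 0 (Nat.zero_le _),
      ?_, ?_, ?_⟩
    · apply List.ext_getElem
      · simp [h.length_rules]
      · intro i h1 h2
        have h3 := h.unfold_str (i + 1) h2
        simp only [str] at h3
        simpa [h2, h.length_rules, Nat.lt_succ_of_lt h2] using h3
    · refine h.two_le_count.trans (le_of_eq ?_)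
      have := count_rhs ⟨g'.start, g'.rules.take g.rules.length⟩ g.freshSym
      simp only [rhs] at this
      rw [this]
      have hl : (g'.rules.take g.rules.length).length = g.rules.length := by
        simp [h.length_rules]
      rw [hl]
      refine Finset.sum_congr rfl fun j hj => ?_
      cases j with
      | zero => rfl
      | succ i =>
        have hi : i < g.rules.length := by
          have := Finset.mem_range.1 hj; omega
        simp [str, hi]
    · cases g' with
      | mk s l =>
        have h1 := h.length_rules
        have h2 := h.str_last
        simp only [FullGrammar.mk.injEq, true_and]
        simp only at h1
        conv_lhs => rw [← List.take_append_drop g.rules.length l]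
        congr 1
        have h3 : g.rules.length < l.length := by omega
        rw [List.drop_eq_getElem_cons h3, List.drop_eq_nil_of_le (by omega)]
        simp only [str] at h2
        rw [← h2]
        simp [h3]

/-- The replacement given by the strings that remain. -/
theorem exists_rep (g : FullGrammar α) (w : List (GSym α)) (f : ℕ → List (GSym α))
    (hw : 2 ≤ w.length)
    (hf : ∀ j ≤ g.rules.length, FullGrammar.unfold g.freshSym w (f j) = g.str j)
    (hc : 2 ≤ ∑ j ∈ Finset.range (g.rules.length + 1), (f j).count g.freshSym) :
    ∃ g', Rep g w g' ∧ ∀ j ≤ g.rules.length, g'.str j = f j := by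
  let f' : ℕ → List (GSym α) := fun j => if j ≤ g.rules.length then f j else w
  have h1 : ∀ j ≤ g.rules.length, str (ofStrings f' (g.rules.length + 1)) j = f j := by
    intro j hj
    rw [str_ofStrings _ (by omega)]
    exact if_pos hj
  refine ⟨ofStrings f' (g.rules.length + 1), ⟨hw, length_rules_ofStrings _ _, ?_, ?_, ?_⟩, h1⟩
  · intro j hj; rw [h1 j hj]; exact hf j hj
  · rw [str_ofStrings _ le_rfl]
    exact if_neg (by omega)
  · refine hc.trans (le_of_eq (Finset.sum_congr rfl fun j hj => ?_))
    rw [h1 j (Nat.lt_succ_iff.1 (Finset.mem_range.1 hj))]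

theorem Rep.count_str {g g' : FullGrammar α} {w : List (GSym α)} (h : Rep g w g') {x : GSym α}
    (hx : x ≠ g.freshSym) {j : ℕ} (hj : j ≤ g.rules.length) :
    (g.str j).count x = (g'.str j).count x + (g'.str j).count g.freshSym * w.count x := by
  rw [← h.unfold_str j hj, count_unfold hx]

theorem Rep.length_str {g g' : FullGrammar α} {w : List (GSym α)} (h : Rep g w g')
    {j : ℕ} (hj : j ≤ g.rules.length) :
    (g.str j).length + (g'.str j).count g.freshSym =
      (g'.str j).length + (g'.str j).count g.freshSym * w.length := by
  rw [← h.unfold_str j hj, length_unfold]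

/-- The size after a replacement of `f` occurrences of `w`. -/
theorem Rep.size_eq {g g' : FullGrammar α} {w : List (GSym α)} (h : Rep g w g') :
    g'.size + (∑ j ∈ Finset.range (g.rules.length + 1), (g'.str j).count g.freshSym) * w.length =
      g.size + (∑ j ∈ Finset.range (g.rules.length + 1), (g'.str j).count g.freshSym) +
        w.length := by
  rw [size_eq_sum, size_eq_sum, h.length_rules, Finset.sum_range_succ, h.str_last, Finset.sum_mul,
    ← Finset.sum_add_distrib,
    Finset.sum_congr rfl fun j hj => h.length_str (Nat.lt_succ_iff.1 (Finset.mem_range.1 hj)),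
    Finset.sum_add_distrib]
  ring

theorem Rep.size_le {g g' : FullGrammar α} {w : List (GSym α)} (h : Rep g w g') :
    g'.size ≤ g.size := by
  have h1 := h.size_eq
  have h2 := h.two_le
  have h3 := h.two_le_count
  set f := ∑ j ∈ Finset.range (g.rules.length + 1), (g'.str j).count g.freshSym
  obtain ⟨a, ha⟩ := Nat.exists_eq_add_of_le h2
  obtain ⟨b, hb⟩ := Nat.exists_eq_add_of_le h3
  rw [ha, hb] at h1
  nlinarith [Nat.zero_le (a * b)]

/-- A replacement to which Greedy prefers no other. -/
structure GRep (g : FullGrammar α) (w : List (GSym α)) (g' : FullGrammar α) : Prop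
    extends Rep g w g' where
  minimal : ∀ w₂ g₂, Rep g w₂ g₂ → g'.size ≤ g₂.size

theorem greedyStep_iff (g g' : FullGrammar α) : GreedyStep g g' ↔ ∃ w, GRep g w g' := by
  unfold GreedyStep
  simp only [isReplacement_iff_rep]
  constructor
  · rintro ⟨⟨w, h1⟩, h2⟩; exact ⟨w, h1, h2⟩
  · rintro ⟨w, h1, h2⟩; exact ⟨⟨w, h1⟩, h2⟩

end Replacement

end FullGrammar

/-! ### Invariants of a run of Greedy -/

namespace FullGrammar

section Invariants

variable {α : Type} [DecidableEq α]

/-- Only nonterminals that have a rule occur. -/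
def WellFormed (g : FullGrammar α) : Prop :=
  ∀ j ≤ g.rules.length, ∀ i, Sum.inr i ∈ g.str j → i < g.rules.length

omit [DecidableEq α] in
theorem WellFormed.freshSym_notMem {g : FullGrammar α} (h : g.WellFormed) {j : ℕ}
    (hj : j ≤ g.rules.length) : g.freshSym ∉ g.str j :=
  fun hm => lt_irrefl _ (h j hj _ hm)

theorem Rep.exists_mem {g g' : FullGrammar α} {w : List (GSym α)} (h : Rep g w g') {j₀ : ℕ}
    (hc : (g'.str j₀).count g.freshSym ≤ 1) :
    ∃ j ≤ g.rules.length, j ≠ j₀ ∧ g.freshSym ∈ g'.str j := by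
  by_contra! hno
  have h1 : ∑ j ∈ Finset.range (g.rules.length + 1), (g'.str j).count g.freshSym ≤
      ∑ j ∈ Finset.range (g.rules.length + 1), if j = j₀ then 1 else 0 := by
    refine Finset.sum_le_sum fun j hj => ?_
    split_ifs with h2
    · rw [h2]; exact hc
    · exact (List.count_eq_zero_of_not_mem
        (hno j (Nat.lt_succ_iff.1 (Finset.mem_range.1 hj)) h2)).le
  have h2 := h.two_le_count
  rw [Finset.sum_ite_eq'] at h1
  split_ifs at h1 <;> omega

theorem Rep.exists_mem' {g g' : FullGrammar α} {w : List (GSym α)} (h : Rep g w g') :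
    ∃ j ≤ g.rules.length, g.freshSym ∈ g'.str j := by
  by_cases hc : (g'.str 0).count g.freshSym ≤ 1
  · obtain ⟨j, hj, _, hm⟩ := h.exists_mem hc
    exact ⟨j, hj, hm⟩
  · exact ⟨0, Nat.zero_le _, List.count_pos_iff.1 (by omega)⟩

theorem Rep.infix_str {g g' : FullGrammar α} {w : List (GSym α)} (h : Rep g w g') {j : ℕ}
    (hj : j ≤ g.rules.length) (hm : g.freshSym ∈ g'.str j) : w <:+: g.str j := by
  rw [← h.unfold_str j hj]
  exact infix_unfold_of_mem hm w

theorem Rep.freshSym_notMem {g g' : FullGrammar α} {w : List (GSym α)} (h : Rep g w g')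
    (hg : g.WellFormed) : g.freshSym ∉ w := by
  obtain ⟨j, hj, hm⟩ := h.exists_mem'
  exact fun hw => hg.freshSym_notMem hj ((h.infix_str hj hm).subset hw)

theorem Rep.mem_of_mem {g g' : FullGrammar α} {w : List (GSym α)} (h : Rep g w g') {j : ℕ}
    (hj : j ≤ g.rules.length) {x : GSym α} (hx : x ≠ g.freshSym) (hm : x ∈ g'.str j) :
    x ∈ g.str j := by
  have := h.count_str hx hj
  have h2 := List.count_pos_iff.2 hm
  exact List.count_pos_iff.1 (by omega)

theorem Rep.wellFormed {g g' : FullGrammar α} {w : List (GSym α)} (h : Rep g w g')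
    (hg : g.WellFormed) : g'.WellFormed := by
  intro j hj i hi
  rw [h.length_rules] at hj ⊢
  by_cases hj' : j ≤ g.rules.length
  · by_cases hx : (Sum.inr i : GSym α) = g.freshSym
    · rw [freshSym, Sum.inr.injEq] at hx; omega
    · exact (hg j hj' i (h.mem_of_mem hj' hx hi)).trans (Nat.lt_succ_self _)
  · obtain rfl : j = g.rules.length + 1 := by omega
    rw [h.str_last] at hi
    obtain ⟨j', hj', hm⟩ := h.exists_mem'
    exact (hg j' hj' i ((h.infix_str hj' hm).subset hi)).trans (Nat.lt_succ_self _)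

/-- If a replacement uses fewer occurrences of the same word than another one, then it is worse. -/
theorem Rep.size_lt {g g₁ g₂ : FullGrammar α} {w : List (GSym α)} (h₁ : Rep g w g₁)
    (h₂ : Rep g w g₂) (hlt : ∑ j ∈ Finset.range (g.rules.length + 1), (g₁.str j).count g.freshSym <
      ∑ j ∈ Finset.range (g.rules.length + 1), (g₂.str j).count g.freshSym) :
    g₂.size < g₁.size := by
  have e1 := h₁.size_eq
  have e2 := h₂.size_eq
  have hw := h₁.two_le
  obtain ⟨a, ha⟩ := Nat.exists_eq_add_of_le hw
  obtain ⟨b, hb⟩ := Nat.exists_eq_add_of_lt hlt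
  rw [hb, ha] at e2
  rw [ha] at e1
  nlinarith [Nat.zero_le (a * b)]

/-- An occurrence of `w` that is left over could be replaced as well, which would make the grammar
smaller still. -/
theorem GRep.not_infix {g g' : FullGrammar α} {w : List (GSym α)} (h : GRep g w g')
    (hg : g.WellFormed) {j : ℕ} (hj : j ≤ g.rules.length) : ¬ w <:+: g'.str j := by
  rintro ⟨A, B, hAB⟩
  have hZ := h.freshSym_notMem hg
  let f : ℕ → List (GSym α) := Function.update g'.str j (A ++ g.freshSym :: B)
  have hlt : ∑ j ∈ Finset.range (g.rules.length + 1), (g'.str j).count g.freshSym <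
      ∑ j ∈ Finset.range (g.rules.length + 1), (f j).count g.freshSym := by
    refine Finset.sum_lt_sum (fun i _ => ?_) ⟨j, Finset.mem_range.2 (by omega), ?_⟩
    · by_cases hi : i = j
      · subst hi
        simp only [f, Function.update_self, ← hAB, List.count_append, List.count_cons_self,
          List.count_eq_zero_of_not_mem hZ]
        omega
      · simp [f, Function.update_of_ne hi]
    · simp only [f, Function.update_self, ← hAB, List.count_append, List.count_cons_self,
        List.count_eq_zero_of_not_mem hZ]
      omega
  obtain ⟨g₂, h₂, hf⟩ := exists_rep g w f h.two_le (fun i hi => by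
    by_cases hij : i = j
    · subst hij
      rw [← h.unfold_str i hi, ← hAB]
      simp only [f, Function.update_self]
      rw [unfold_append, unfold_cons_self, unfold_append, unfold_append, unfold_of_notMem hZ,
        List.append_assoc]
    · simp only [f, Function.update_of_ne hij]
      exact h.unfold_str i hi) (h.two_le_count.trans hlt.le)
  have h3 := h.toRep.size_lt h₂ (hlt.trans_eq (Finset.sum_congr rfl fun i hi => by
    rw [hf i (Nat.lt_succ_iff.1 (Finset.mem_range.1 hi))]))
  exact absurd (h.minimal w g₂ h₂) (by omega)

/-- No right-hand side of a rule is a factor of another string. -/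
def NoInfix (g : FullGrammar α) : Prop :=
  ∀ i < g.rules.length, ∀ j ≤ g.rules.length, j ≠ i + 1 → ¬ g.str (i + 1) <:+: g.str j

/-- All right-hand sides of rules have length at least two. -/
def LongRules (g : FullGrammar α) : Prop :=
  ∀ i < g.rules.length, 2 ≤ (g.str (i + 1)).length

/-- Unfolding preserves factors, so two old strings give a violation in `g`. An old right-hand side
inside the new one would contain no fresh symbol, hence be unchanged, and `w` occurs in another
string of `g`: again a violation. The new right-hand side is excluded by `GRep.not_infix`. -/
theorem GRep.noInfix {g g' : FullGrammar α} {w : List (GSym α)} (h : GRep g w g')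
    (hg : g.WellFormed) (hn : g.NoInfix) : g'.NoInfix := by
  intro i hi j hj hne hinf
  rw [h.length_rules] at hi hj
  rcases Nat.lt_succ_iff_lt_or_eq.1 hi with hi' | rfl
  · have hv := h.unfold_str (i + 1) hi'
    by_cases hj' : j ≤ g.rules.length
    · refine hn i hi' j hj' hne ?_
      rw [← hv, ← h.unfold_str j hj']
      exact unfold_infix hinf _ _
    · obtain rfl : j = g.rules.length + 1 := by omega
      rw [h.str_last] at hinf
      have hZ : g.freshSym ∉ g'.str (i + 1) :=
        fun hm => h.freshSym_notMem hg (hinf.subset hm)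
      rw [unfold_of_notMem hZ] at hv
      obtain ⟨j', hj', hne', hm⟩ := h.exists_mem (j₀ := i + 1)
        (by rw [List.count_eq_zero_of_not_mem hZ]; omega)
      refine hn i hi' j' hj' hne' ?_
      rw [← hv]
      exact hinf.trans (h.infix_str hj' hm)
  · rw [h.str_last] at hinf
    exact h.not_infix hg (by omega) hinf

/-- A right-hand side can shrink to one symbol only if it was `w` itself. But `w` also occurs in
another string, against `NoInfix`. -/
theorem Rep.longRules {g g' : FullGrammar α} {w : List (GSym α)} (h : Rep g w g')
    (hn : g.NoInfix) (hl : g.LongRules) : g'.LongRules := by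
  intro i hi
  rw [h.length_rules] at hi
  rcases Nat.lt_succ_iff_lt_or_eq.1 hi with hi' | rfl
  · by_contra hlt
    have hv := h.unfold_str (i + 1) hi'
    have h2 := hl i hi'
    obtain ⟨s, hs⟩ | hs : (∃ s, g'.str (i + 1) = [s]) ∨ g'.str (i + 1) = [] := by
      match hs : g'.str (i + 1) with
      | [] => exact Or.inr rfl
      | [s] => exact Or.inl ⟨s, rfl⟩
      | s :: t :: u => rw [hs] at hlt; simp at hlt
    · by_cases hsx : s = g.freshSym
      · obtain ⟨j', hj', hne', hm⟩ := h.exists_mem (j₀ := i + 1) (by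
          rw [hs]; exact List.count_le_length)
        refine hn i hi' j' hj' hne' ?_
        rw [← hv, hs, hsx, unfold_cons_self, unfold_nil, List.append_nil]
        exact h.infix_str hj' hm
      · rw [hs, unfold_cons_of_ne hsx, unfold_nil] at hv
        rw [← hv] at h2; simp at h2
    · rw [hs, unfold_nil] at hv
      rw [← hv] at h2; simp at h2
  · rw [h.str_last]; exact h.two_le

/-- No nonterminal is followed by the same symbol at all of its occurrences. -/
def RightVaried (g : FullGrammar α) : Prop :=
  ∀ i < g.rules.length, ∀ y : GSym α, ∃ j ≤ g.rules.length, ∃ A B,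
    g.str j = A ++ Sum.inr i :: B ∧ B.head? ≠ some y

/-- If `x` is always followed by `y`, then `y` can be moved into the word that `x` stands for. -/
theorem exists_absorb_right {x y : GSym α} (hxy : y ≠ x) (w : List (GSym α)) (n : ℕ)
    (s : List (GSym α)) (hn : s.length ≤ n)
    (hs : ∀ A B, s = A ++ x :: B → B.head? = some y) :
    ∃ s', FullGrammar.unfold x (w ++ [y]) s' = FullGrammar.unfold x w s ∧
      s'.count x = s.count x := by
  induction n generalizing s with
  | zero =>
    obtain rfl : s = [] := List.length_eq_zero_iff.1 (by omega)
    exact ⟨[], rfl, rfl⟩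
  | succ n ih =>
    match s with
    | [] => exact ⟨[], rfl, rfl⟩
    | a :: t =>
      by_cases ha : a = x
      · subst ha
        have h1 := hs [] t rfl
        match t, h1 with
        | b :: t, h1 =>
          obtain rfl : b = y := by simpa using h1
          obtain ⟨s', h2, h3⟩ := ih t (by simp at hn; omega)
            (fun A B h => hs (a :: b :: A) B (by rw [h]; rfl))
          refine ⟨a :: s', ?_, ?_⟩
          · rw [unfold_cons_self, unfold_cons_self, unfold_cons_of_ne hxy, h2, List.append_assoc]
            rfl
          · rw [List.count_cons_self, List.count_cons_self, List.count_cons_of_ne hxy, h3]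
      · obtain ⟨s', h2, h3⟩ := ih t (by simp at hn; omega)
          (fun A B h => hs (a :: A) B (by rw [h]; rfl))
        exact ⟨a :: s', by rw [unfold_cons_of_ne ha, unfold_cons_of_ne ha, h2], by
          rw [List.count_cons_of_ne ha, List.count_cons_of_ne ha, h3]⟩

theorem exists_not_followed_by_self {x : GSym α} {s : List (GSym α)} (h : x ∈ s) :
    ∃ A B, s = A ++ x :: B ∧ B.head? ≠ some x := by
  induction s with
  | nil => simp at h
  | cons a s ih =>
    by_cases hs : x ∈ s
    · obtain ⟨A, B, h1, h2⟩ := ih hs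
      exact ⟨a :: A, B, by rw [h1]; rfl, h2⟩
    · obtain rfl : x = a := by simpa [hs] using h
      refine ⟨[], s, rfl, fun hh => hs ?_⟩
      exact List.mem_of_mem_head? hh

/-- If `y` followed all f ≥ 2 occurrences of the fresh symbol, then replacing `w ++ [y]` instead
would save f - 1 more symbols. -/
theorem GRep.exists_not_followed {g g' : FullGrammar α} {w : List (GSym α)} (h : GRep g w g')
    (y : GSym α) : ∃ j ≤ g.rules.length, ∃ A B,
      g'.str j = A ++ g.freshSym :: B ∧ B.head? ≠ some y := by
  by_cases hy : y = g.freshSym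
  · obtain ⟨j, hj, hm⟩ := h.exists_mem'
    obtain ⟨A, B, h1, h2⟩ := exists_not_followed_by_self hm
    exact ⟨j, hj, A, B, h1, by rwa [hy]⟩
  by_contra! hno
  choose! f hf1 hf2 using fun j (hj : j ≤ g.rules.length) =>
    exists_absorb_right hy w _ (g'.str j) le_rfl (fun A B hAB => hno j hj A B hAB)
  have hsum : ∑ j ∈ Finset.range (g.rules.length + 1), (f j).count g.freshSym =
      ∑ j ∈ Finset.range (g.rules.length + 1), (g'.str j).count g.freshSym :=
    Finset.sum_congr rfl fun j hj => hf2 j (Nat.lt_succ_iff.1 (Finset.mem_range.1 hj))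
  obtain ⟨g₂, h₂, hf⟩ := exists_rep g (w ++ [y]) f
    (by have := h.two_le; simp; omega) (fun j hj => by rw [hf1 j hj, h.unfold_str j hj])
    (h.two_le_count.trans_eq hsum.symm)
  have e1 := h.size_eq
  have e2 := h₂.size_eq
  have hmin := h.minimal _ _ h₂
  have hc := h.two_le_count
  rw [Finset.sum_congr rfl fun j hj => by
    rw [hf j (Nat.lt_succ_iff.1 (Finset.mem_range.1 hj))], hsum, List.length_append,
    List.length_singleton, mul_add, mul_one] at e2
  omega

/-- An occurrence of an old nonterminal with a suitable right neighbour in `g` survives either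
outside the replaced words or in the new right-hand side. -/
theorem GRep.rightVaried {g g' : FullGrammar α} {w : List (GSym α)} (h : GRep g w g')
    (hg : g.WellFormed) (hn : g.RightVaried) : g'.RightVaried := by
  intro i hi y
  rw [h.length_rules] at hi ⊢
  rcases Nat.lt_succ_iff_lt_or_eq.1 hi with hi' | rfl
  · have hix : (Sum.inr i : GSym α) ≠ g.freshSym := by
      rw [freshSym, Ne, Sum.inr.injEq]; omega
    by_cases hy : y = g.freshSym
    · by_cases hiw : (Sum.inr i : GSym α) ∈ w
      · obtain ⟨A, B, hAB⟩ := List.append_of_mem hiw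
        refine ⟨g.rules.length + 1, le_rfl, A, B, by rw [h.str_last, hAB], fun hh => ?_⟩
        apply h.freshSym_notMem hg
        rw [hAB, ← hy]
        exact List.mem_append_right _ (List.mem_cons_of_mem _ (List.mem_of_mem_head? hh))
      · have hw0 : w ≠ [] := by rintro rfl; simpa using h.two_le
        obtain ⟨z, w', rfl⟩ := List.exists_cons_of_ne_nil hw0
        -- In `g'`, being followed by the fresh symbol means being followed by the first symbol `z`
        -- of `w` in `g`.
        obtain ⟨j, hj, A, B, hAB, hB⟩ := hn i hi' z
        rw [← h.unfold_str j hj] at hAB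
        rcases unfold_eq_append_cons hAB with ⟨A', B', h1, h2, h3⟩ | ⟨A', B', w₁, w₂, h1, h2, -⟩
        · refine ⟨j, by omega, A', B', h1, fun hh => hB ?_⟩
          match B', hh with
          | b :: B', hh =>
            obtain rfl : b = y := by simpa using hh
            rw [← h3, hy, unfold_cons_self]; rfl
        · exact absurd (by rw [h2]; simp) hiw
    · obtain ⟨j, hj, A, B, hAB, hB⟩ := hn i hi' y
      rw [← h.unfold_str j hj] at hAB
      rcases unfold_eq_append_cons hAB with ⟨A', B', h1, h2, h3⟩ | ⟨A', B', w₁, w₂, h1, h2, h3, h4⟩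
      · refine ⟨j, by omega, A', B', h1, fun hh => hB ?_⟩
        match B', hh with
        | b :: B', hh =>
          obtain rfl : b = y := by simpa using hh
          rw [← h3, unfold_cons_of_ne hy]; rfl
      · refine ⟨g.rules.length + 1, le_rfl, w₁, w₂, by rw [h.str_last, h2], fun hh => hB ?_⟩
        rw [← h4]
        match w₂, hh with
        | b :: w₂, hh => exact hh
  · obtain ⟨j, hj, A, B, h1, h2⟩ := h.exists_not_followed y
    exact ⟨j, by omega, A, B, h1, h2⟩

/-- The mirror image of a grammar. -/
def mirror (g : FullGrammar α) : FullGrammar α := ⟨g.start.reverse, g.rules.map List.reverse⟩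

omit [DecidableEq α] in
theorem length_rules_mirror (g : FullGrammar α) : g.mirror.rules.length = g.rules.length := by
  simp [mirror]

omit [DecidableEq α] in
theorem str_mirror (g : FullGrammar α) (j : ℕ) : g.mirror.str j = (g.str j).reverse := by
  cases j with
  | zero => rfl
  | succ i =>
    simp only [str, mirror]
    by_cases hi : i < g.rules.length
    · simp [hi]
    · simp [Nat.le_of_not_lt hi]

omit [DecidableEq α] in
theorem mirror_mirror (g : FullGrammar α) : g.mirror.mirror = g := by
  cases g; simp [mirror]

omit [DecidableEq α] in
theorem freshSym_mirror (g : FullGrammar α) : g.mirror.freshSym = g.freshSym := by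
  rw [freshSym, freshSym, length_rules_mirror]

omit [DecidableEq α] in
theorem size_mirror (g : FullGrammar α) : g.mirror.size = g.size := by
  rw [size_eq_sum, size_eq_sum, length_rules_mirror]
  simp [str_mirror]

theorem Rep.mirror {g g' : FullGrammar α} {w : List (GSym α)} (h : Rep g w g') :
    Rep g.mirror w.reverse g'.mirror where
  two_le := by simpa using h.two_le
  length_rules := by rw [length_rules_mirror, length_rules_mirror, h.length_rules]
  unfold_str j hj := by
    rw [length_rules_mirror] at hj
    rw [freshSym_mirror, str_mirror, str_mirror, unfold_reverse, h.unfold_str j hj]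
  str_last := by rw [length_rules_mirror, str_mirror, h.str_last]
  two_le_count := by
    rw [length_rules_mirror, freshSym_mirror]
    simpa [str_mirror] using h.two_le_count

/-- Sizes do not change under reversal, so Greedy's choices remain optimal, and every statement on
right neighbours yields one on left neighbours. -/
theorem GRep.mirror {g g' : FullGrammar α} {w : List (GSym α)} (h : GRep g w g') :
    GRep g.mirror w.reverse g'.mirror where
  toRep := h.toRep.mirror
  minimal w₂ g₂ h₂ := by
    have h3 := h₂.mirror
    rw [mirror_mirror] at h3
    have := h.minimal _ _ h3
    rwa [size_mirror] at this ⊢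

omit [DecidableEq α] in
theorem WellFormed.mirror {g : FullGrammar α} (h : g.WellFormed) : g.mirror.WellFormed := by
  intro j hj i hi
  rw [length_rules_mirror] at hj ⊢
  rw [str_mirror, List.mem_reverse] at hi
  exact h j hj i hi

/-- Every nonterminal occurs at least twice. -/
def UsedTwice (g : FullGrammar α) : Prop :=
  ∀ i < g.rules.length, 2 ≤ ∑ j ∈ Finset.range (g.rules.length + 1), (g.str j).count (Sum.inr i)

/-- The only occurrence of the nonterminal is the one in `w`; a symbol after it there would be its
constant right neighbour, against `RightVaried`. -/
theorem Rep.eq_concat_of_count {g g' : FullGrammar α} {w : List (GSym α)} (h : Rep g w g')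
    (hn : g'.RightVaried) {i : ℕ} (hi : i < g.rules.length) (hw : w.count (Sum.inr i) = 1)
    (h0 : ∀ j ≤ g.rules.length, Sum.inr i ∉ g'.str j) : ∃ w₁, w = w₁ ++ [Sum.inr i] := by
  obtain ⟨w₁, w₂, hw'⟩ := List.append_of_mem (List.count_pos_iff.1 (hw.symm ▸ Nat.one_pos))
  cases w₂ with
  | nil => exact ⟨w₁, hw'⟩
  | cons y w₂ =>
    obtain ⟨j, hj, A, B, hAB, hB⟩ := hn i (by rw [h.length_rules]; omega) y
    rw [h.length_rules] at hj
    have hj' : j = g.rules.length + 1 := by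
      by_contra hne
      exact h0 j (by omega) (by rw [hAB]; simp)
    rw [hj', h.str_last] at hAB
    have c1 := hw
    have c2 := hw
    rw [hw', List.count_append, List.count_cons_self] at c1
    rw [hAB, List.count_append, List.count_cons_self] at c2
    have n1 : Sum.inr i ∉ w₁ := fun hm => by have := List.count_pos_iff.2 hm; omega
    have n2 : Sum.inr i ∉ A := fun hm => by have := List.count_pos_iff.2 hm; omega
    have n3 : Sum.inr i ∉ B := fun hm => by have := List.count_pos_iff.2 hm; omega
    obtain ⟨-, -, h3⟩ := (List.append_cons_inj_of_notMem n2 n3).1 (hAB.symm.trans hw')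
    rw [h3] at hB
    simp at hB

/-- An old nonterminal can drop to one occurrence only if that occurrence lies in the new right-hand
side `w`. By variedness on both sides it is then both the last and the first symbol of `w`, which is
impossible as `w` has length at least two. -/
theorem Rep.usedTwice {g g' : FullGrammar α} {w : List (GSym α)} (h : Rep g w g')
    (hr : g'.RightVaried) (hl : g'.mirror.RightVaried) (hu : g.UsedTwice) :
    g'.UsedTwice := by
  intro i hi
  rw [h.length_rules] at hi ⊢
  rw [Finset.sum_range_succ, h.str_last]
  rcases Nat.lt_succ_iff_lt_or_eq.1 hi with hi' | rfl
  · have hix : (Sum.inr i : GSym α) ≠ g.freshSym := by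
      rw [freshSym, Ne, Sum.inr.injEq]; omega
    have h1 := hu i hi'
    have h2 : ∀ j ∈ Finset.range (g.rules.length + 1), (g.str j).count (Sum.inr i) =
        (g'.str j).count (Sum.inr i) + (g'.str j).count g.freshSym * w.count (Sum.inr i) :=
      fun j hj => h.count_str hix (Nat.lt_succ_iff.1 (Finset.mem_range.1 hj))
    rw [Finset.sum_congr rfl h2, Finset.sum_add_distrib, ← Finset.sum_mul] at h1
    by_contra hlt
    have hw1 : w.count (Sum.inr i) = 1 := by
      rcases Nat.eq_zero_or_pos (w.count (Sum.inr i)) with h0 | h0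
      · rw [h0, mul_zero] at h1; omega
      · omega
    have hsum : ∑ j ∈ Finset.range (g.rules.length + 1), (g'.str j).count (Sum.inr i) = 0 := by
      omega
    have h0 : ∀ j ≤ g.rules.length, (Sum.inr i : GSym α) ∉ g'.str j := fun j hj =>
      List.count_eq_zero.1 (Finset.sum_eq_zero_iff.1 hsum j (Finset.mem_range.2 (by omega)))
    obtain ⟨w₁, hw₁⟩ := h.eq_concat_of_count hr hi' hw1 h0
    obtain ⟨w₂, hw₂⟩ := h.mirror.eq_concat_of_count hl (by rwa [length_rules_mirror])
      (by rwa [List.count_reverse])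
      (fun j hj => by
        rw [length_rules_mirror] at hj
        rw [str_mirror, List.mem_reverse]; exact h0 j hj)
    have hw₃ : w = Sum.inr i :: w₂.reverse := by
      rw [← List.reverse_inj, hw₂]; simp
    cases w₁ with
    | nil => have := h.two_le; rw [hw₁] at this; simp at this
    | cons b w₁ =>
      rw [hw₁] at hw₃
      obtain ⟨rfl, -⟩ := List.cons.inj hw₃
      rw [hw₁] at hw1
      simp [List.count_append] at hw1
  · exact h.two_le_count.trans (Nat.le_add_right _ _)

/-- The properties that the grammars of a run of Greedy have. -/
structure Invariant (g : FullGrammar α) : Prop where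
  wellFormed : g.WellFormed
  noInfix : g.NoInfix
  longRules : g.LongRules
  rightVaried : g.RightVaried
  leftVaried : g.mirror.RightVaried
  usedTwice : g.UsedTwice

theorem Invariant.step {g g' : FullGrammar α} {w : List (GSym α)} (hg : g.Invariant)
    (h : GRep g w g') : g'.Invariant where
  wellFormed := h.wellFormed hg.wellFormed
  noInfix := h.noInfix hg.wellFormed hg.noInfix
  longRules := h.longRules hg.noInfix hg.longRules
  rightVaried := h.rightVaried hg.wellFormed hg.rightVaried
  leftVaried := h.mirror.rightVaried hg.wellFormed.mirror hg.leftVaried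
  usedTwice := h.usedTwice (h.rightVaried hg.wellFormed hg.rightVaried)
    (h.mirror.rightVaried hg.wellFormed.mirror hg.leftVaried) hg.usedTwice

theorem invariant_ofString (S : List α) : (ofString S).Invariant where
  wellFormed := by
    intro j hj i hi
    obtain rfl : j = 0 := by simpa [ofString] using hj
    simp [ofString, str] at hi
  noInfix i hi := by simp [ofString] at hi
  longRules i hi := by simp [ofString] at hi
  rightVaried i hi := by simp [ofString] at hi
  leftVaried i hi := by simp [ofString, mirror] at hi
  usedTwice i hi := by simp [ofString] at hi

end Invariants

end FullGrammar

/-! ### Expansions of nonterminals -/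

namespace FullGrammar

section Valuation

variable {α : Type}

/-- The expansion of a symbol, given the expansions of the nonterminals. -/
def symVal (E : ℕ → List α) : GSym α → List α
  | Sum.inl a => [a]
  | Sum.inr i => E i

/-- `E i` is the expansion of the nonterminal `i`, and `g` is a grammar of `S`. -/
structure IsValuation (g : FullGrammar α) (S : List α) (E : ℕ → List α) : Prop where
  start : (g.str 0).flatMap (symVal E) = S
  rule : ∀ i < g.rules.length, (g.str (i + 1)).flatMap (symVal E) = E i
  two_le : ∀ i < g.rules.length, 2 ≤ (E i).length

theorem symVal_update {E : ℕ → List α} {r : ℕ} {v : List α} {x : GSym α} (h : x ≠ Sum.inr r) :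
    symVal (Function.update E r v) x = symVal E x := by
  cases x with
  | inl a => rfl
  | inr i =>
    have : i ≠ r := fun hh => h (by rw [hh])
    simp [symVal, this]

theorem flatMap_symVal_update {E : ℕ → List α} {r : ℕ} {v : List α} {u : List (GSym α)}
    (h : Sum.inr r ∉ u) :
    u.flatMap (symVal (Function.update E r v)) = u.flatMap (symVal E) := by
  induction u with
  | nil => rfl
  | cons x u ih =>
    rw [List.mem_cons, not_or] at h
    rw [List.flatMap_cons, List.flatMap_cons, ih h.2, symVal_update (Ne.symm h.1)]

theorem length_le_length_flatMap {β γ : Type*} (f : β → List γ) (u : List β)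
    (h : ∀ x ∈ u, 1 ≤ (f x).length) : u.length ≤ (u.flatMap f).length := by
  induction u with
  | nil => simp
  | cons x u ih =>
    have h1 := ih fun y hy => h y (List.mem_cons_of_mem _ hy)
    have h2 := h x List.mem_cons_self
    simp only [List.flatMap_cons, List.length_append, List.length_cons]
    omega

theorem length_lt_length_flatMap {β γ : Type*} (f : β → List γ) (u : List β)
    (h : ∀ x ∈ u, 1 ≤ (f x).length) (hu : 2 ≤ u.length) {x : β} (hx : x ∈ u) :
    (f x).length < (u.flatMap f).length := by
  obtain ⟨A, B, rfl⟩ := List.append_of_mem hx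
  have h1 := length_le_length_flatMap f A fun y hy => h y (by simp [hy])
  have h2 := length_le_length_flatMap f B fun y hy => h y (by simp [hy])
  simp only [List.flatMap_append, List.flatMap_cons, List.length_append, List.length_cons]
    at hu ⊢
  omega

theorem IsValuation.one_le {g : FullGrammar α} {S : List α} {E : ℕ → List α}
    (hE : g.IsValuation S E) (hg : g.WellFormed) {j : ℕ} (hj : j ≤ g.rules.length)
    {x : GSym α} (hx : x ∈ g.str j) : 1 ≤ (symVal E x).length := by
  cases x with
  | inl a => simp [symVal]
  | inr i => exact (Nat.le_succ 1).trans (hE.two_le i (hg j hj i hx))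

variable [DecidableEq α]

theorem IsValuation.step {g g' : FullGrammar α} {S : List α} {E : ℕ → List α}
    (hE : g.IsValuation S E) (hg : g.WellFormed) {w : List (GSym α)} (h : Rep g w g') :
    g'.IsValuation S (Function.update E g.rules.length (w.flatMap (symVal E))) := by
  set E' := Function.update E g.rules.length (w.flatMap (symVal E)) with hE'
  have hZ : symVal E' g.freshSym = w.flatMap (symVal E') := by
    rw [flatMap_symVal_update (h.freshSym_notMem hg)]
    simp [symVal, freshSym, E']
  have hstr : ∀ j ≤ g.rules.length,
      (g'.str j).flatMap (symVal E') = (g.str j).flatMap (symVal E) := by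
    intro j hj
    rw [← flatMap_unfold (symVal E') g.freshSym w _ hZ, h.unfold_str j hj,
      flatMap_symVal_update (hg.freshSym_notMem hj)]
  refine ⟨(hstr 0 (Nat.zero_le _)).trans hE.start, fun i hi => ?_, fun i hi => ?_⟩
  · rw [h.length_rules] at hi
    rcases Nat.lt_succ_iff_lt_or_eq.1 hi with hi' | rfl
    · rw [hstr _ hi', hE.rule i hi', hE', Function.update_of_ne (by omega)]
    · rw [h.str_last, ← hZ]; rfl
  · rw [h.length_rules] at hi
    rcases Nat.lt_succ_iff_lt_or_eq.1 hi with hi' | rfl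
    · rw [hE', Function.update_of_ne (by omega)]; exact hE.two_le i hi'
    · rw [hE', Function.update_self]
      obtain ⟨j, hj, hm⟩ := h.exists_mem'
      exact h.two_le.trans (length_le_length_flatMap _ _ fun x hx =>
        hE.one_le hg hj ((h.infix_str hj hm).subset hx))

/-- Going backwards the same `E` works, so distinctness of the final expansions passes to all
intermediate grammars. -/
theorem IsValuation.of_step {g g' : FullGrammar α} {S : List α} {E : ℕ → List α}
    (hE : g'.IsValuation S E) {w : List (GSym α)} (h : Rep g w g') : g.IsValuation S E := by
  have hl := h.length_rules
  have hZ : symVal E g.freshSym = w.flatMap (symVal E) := by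
    have := hE.rule g.rules.length (by omega)
    rw [h.str_last] at this
    exact this.symm
  have hstr : ∀ j ≤ g.rules.length,
      (g.str j).flatMap (symVal E) = (g'.str j).flatMap (symVal E) := by
    intro j hj
    rw [← h.unfold_str j hj, flatMap_unfold _ _ _ _ hZ]
  exact ⟨(hstr 0 (Nat.zero_le _)).trans hE.start,
    fun i hi => (hstr _ hi).trans (hE.rule i (by omega)), fun i hi => hE.two_le i (by omega)⟩

omit [DecidableEq α] in
theorem isValuation_ofString (S : List α) : (ofString S).IsValuation S fun _ => [] where
  start := by
    simp only [str, ofString]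
    induction S with
    | nil => rfl
    | cons a S ih => rw [List.map_cons, List.flatMap_cons, ih]; rfl
  rule i hi := by simp [ofString] at hi
  two_le i hi := by simp [ofString] at hi

omit [DecidableEq α] in
theorem expands_of_symbols {g : FullGrammar α} {E : ℕ → List α} (u : List (GSym α))
    (h : ∀ i, Sum.inr i ∈ u → i < g.rules.length ∧ g.Expands (g.str (i + 1)) (E i)) :
    g.Expands u (u.flatMap (symVal E)) := by
  induction u with
  | nil => exact Expands.nil
  | cons x u ih =>
    have h1 := ih fun i hi => h i (List.mem_cons_of_mem _ hi)
    rw [List.flatMap_cons]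
    cases x with
    | inl a => exact Expands.letter a _ _ h1
    | inr i =>
      obtain ⟨hi, h2⟩ := h i List.mem_cons_self
      exact Expands.nonterminal i (g.str (i + 1)) _ _ _ (by simp [str, hi]) h2 h1

-- Induction on the length of the expansion: right-hand sides have at least two symbols, so the
-- nonterminals in them have strictly shorter expansions.
omit [DecidableEq α] in
theorem IsValuation.expands {g : FullGrammar α} {S : List α} {E : ℕ → List α}
    (hE : g.IsValuation S E) (hg : g.WellFormed) (hl : g.LongRules) {i : ℕ}
    (hi : i < g.rules.length) : g.Expands [Sum.inr i] (E i) := by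
  have key : ∀ n i, i < g.rules.length → (E i).length ≤ n →
      g.Expands (g.str (i + 1)) (E i) := by
    intro n
    induction n with
    | zero => intro i hi hn; have := hE.two_le i hi; omega
    | succ n ih =>
      intro i hi hn
      have h1 := expands_of_symbols (g := g) (E := E) (g.str (i + 1)) (fun i' hi' => by
        have hlt := length_lt_length_flatMap (symVal E) _ (fun x hx => hE.one_le hg hi hx)
          (hl i hi) hi'
        have hi'' := hg _ hi i' hi'
        refine ⟨hi'', ih i' hi'' ?_⟩
        rw [hE.rule i hi] at hlt
        have : (E i').length < (E i).length := hlt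
        omega)
      rwa [hE.rule i hi] at h1
  have := expands_of_symbols (g := g) (E := E) [Sum.inr i] (fun i' hi' => by
    obtain rfl : i' = i := by simpa using hi'
    exact ⟨hi, key _ _ hi le_rfl⟩)
  simpa [symVal] using this

end Valuation

/-! ### Neighbouring pairs in a word -/

section Adjacency

variable {β : Type*}

/-- The pairs of neighbouring symbols of a word. -/
def adj : List β → List (β × β)
  | [] => []
  | [_] => []
  | a :: b :: l => (a, b) :: adj (b :: l)

theorem adj_append (A B : List β) : ∃ J : Multiset (β × β), J.card ≤ 1 ∧
    (adj (A ++ B) : Multiset (β × β)) = adj A + adj B + J := by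
  induction A with
  | nil => exact ⟨0, by simp, by simp [adj]⟩
  | cons a A ih =>
    cases A with
    | nil =>
      cases B with
      | nil => exact ⟨0, by simp, by simp [adj]⟩
      | cons b B =>
        refine ⟨{(a, b)}, by simp, ?_⟩
        rw [List.singleton_append, add_comm, Multiset.singleton_add]
        simp [adj]
    | cons a' A =>
      obtain ⟨J, hJ, h⟩ := ih
      refine ⟨J, hJ, ?_⟩
      rw [List.cons_append, List.cons_append, adj, ← List.cons_append, ← Multiset.cons_coe, h, adj,
        ← Multiset.cons_coe, Multiset.cons_add, Multiset.cons_add]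

/-- The only new pairs are those at the two ends of `R`. -/
theorem adj_replace (A R B : List β) (x : β) : ∃ J : Multiset (β × β), J.card ≤ 2 ∧
    (adj (A ++ R ++ B) : Multiset (β × β)) ≤ adj (A ++ x :: B) + adj R + J := by
  obtain ⟨J₁, h₁, e₁⟩ := adj_append A R
  obtain ⟨J₂, h₂, e₂⟩ := adj_append (A ++ R) B
  obtain ⟨J₃, -, e₃⟩ := adj_append A (x :: B)
  obtain ⟨J₄, -, e₄⟩ := adj_append [x] B
  refine ⟨J₁ + J₂, by rw [Multiset.card_add]; omega, ?_⟩
  rw [List.singleton_append] at e₄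
  rw [e₂, e₁, e₃, e₄]
  have : (adj A + (adj [x] + adj B + J₄) + J₃ + adj R + (J₁ + J₂) : Multiset (β × β)) =
      (adj A + adj R + J₁ + adj B + J₂) + (J₃ + J₄) := by
    simp only [adj, Multiset.coe_nil, zero_add]
    abel
  rw [this]
  exact Multiset.le_add_right _ _

/-- The word, cut into pairs. -/
def pairUp : List β → List (β × β)
  | a :: b :: l => (a, b) :: pairUp l
  | _ => []

theorem pairUp_le_adj : ∀ l : List β,
    (pairUp l : Multiset (β × β)) ≤ (adj l : Multiset (β × β))
  | [] => by simp [pairUp]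
  | [_] => by simp [pairUp]
  | [a, b] => by simp [pairUp, adj]
  | a :: b :: c :: l => by
    rw [pairUp, adj, adj, ← Multiset.cons_coe, ← Multiset.cons_coe, ← Multiset.cons_coe]
    exact Multiset.cons_le_cons _ ((pairUp_le_adj (c :: l)).trans (Multiset.le_cons_self _ _))

theorem length_le_pairUp : ∀ l : List β, l.length ≤ 2 * (pairUp l).length + 1
  | [] => by simp
  | [_] => by simp
  | a :: b :: l => by
    have := length_le_pairUp l
    simp only [pairUp, List.length_cons]
    omega

theorem two_mul_pairUp_le : ∀ l : List β, 2 * (pairUp l).length ≤ l.length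
  | [] => by simp [pairUp]
  | [_] => by simp [pairUp]
  | a :: b :: l => by
    have := two_mul_pairUp_le l
    simp only [pairUp, List.length_cons]
    omega

theorem mem_of_mem_pairUp : ∀ (l : List β) (p : β × β), p ∈ pairUp l → p.1 ∈ l ∧ p.2 ∈ l
  | [], p, h => by simp [pairUp] at h
  | [_], p, h => by simp [pairUp] at h
  | a :: b :: l, p, h => by
    rcases List.mem_cons.1 h with rfl | h
    · simp
    · have := mem_of_mem_pairUp l p h
      simp [this.1, this.2]

end Adjacency

/-! ### From a grammar to a parsing of its string -/

section Unroll

variable {α : Type} [DecidableEq α]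

/-- The string `S` is parsed by the strings of the grammar, in which every nonterminal has been
replaced by its right-hand side at one of its occurrences. -/
theorem exists_unroll {g : FullGrammar α} (hg : g.Invariant) {S : List α} {E : ℕ → List α}
    (hE : g.IsValuation S E) : ∃ Y : List (GSym α), Y.flatMap (symVal E) = S ∧
      (Y : Multiset (GSym α)) + (Multiset.range g.rules.length).map Sum.inr =
        (g.rhs : Multiset (GSym α)) ∧
      ∃ J : Multiset (GSym α × GSym α), J.card ≤ 2 * g.rules.length ∧
        (adj Y : Multiset (GSym α × GSym α)) ≤
          ∑ j ∈ Finset.range (g.rules.length + 1), (adj (g.str j) : Multiset _) + J := by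
  set r := g.rules.length with hr
  have key : ∀ u ≤ r, ∃ U ⊆ Finset.range r, U.card = u ∧ ∃ Y : List (GSym α),
      Y.flatMap (symVal E) = S ∧
      (Y : Multiset (GSym α)) + U.val.map Sum.inr =
        (g.str 0 : Multiset (GSym α)) + ∑ i ∈ U, (g.str (i + 1) : Multiset (GSym α)) ∧
      ∃ J : Multiset (GSym α × GSym α), J.card ≤ 2 * u ∧
        (adj Y : Multiset (GSym α × GSym α)) ≤
          (adj (g.str 0) : Multiset (GSym α × GSym α)) +
            ∑ i ∈ U, (adj (g.str (i + 1)) : Multiset (GSym α × GSym α)) + J := by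
    intro u
    induction u with
    | zero =>
      intro _
      exact ⟨∅, by simp, by simp, g.str 0, hE.start, by simp, 0, by simp, by simp⟩
    | succ u ih =>
      intro hu
      obtain ⟨U, hU, hcard, Y, hY, hperm, J, hJ, hadj⟩ := ih (by omega)
      have hne : (Finset.range r \ U).Nonempty := by
        rw [← Finset.card_pos, Finset.card_sdiff_of_subset hU, Finset.card_range]; omega
      -- Nonterminals are unrolled by decreasing length of expansion. A rule whose right-hand side
      -- contains `i` has a longer expansion and is thus already unrolled, so an occurrence of `i`
      -- is available in `Y`.
      obtain ⟨i, hi, hmax⟩ := Finset.exists_max_image _ (fun i => (E i).length) hne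
      obtain ⟨hir, hiU⟩ := Finset.mem_sdiff.1 hi
      have hir' : i < r := Finset.mem_range.1 hir
      have hocc : (Sum.inr i : GSym α) ∈
          (g.str 0 : Multiset (GSym α)) + ∑ i ∈ U, (g.str (i + 1) : Multiset (GSym α)) := by
        have h2 : 2 ≤ ∑ j ∈ Finset.range (r + 1), (g.str j).count (Sum.inr i) :=
          hg.usedTwice i hir'
        obtain ⟨j, hj, hne⟩ := Finset.exists_ne_zero_of_sum_ne_zero
          (by omega : ∑ j ∈ Finset.range (r + 1), (g.str j).count (Sum.inr i) ≠ 0)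
        have hm : (Sum.inr i : GSym α) ∈ g.str j := List.count_pos_iff.1 (Nat.pos_of_ne_zero hne)
        rw [Multiset.mem_add]
        cases j with
        | zero => exact Or.inl hm
        | succ i' =>
          right
          rw [Multiset.mem_sum]
          have hi' : i' < r := by have := Finset.mem_range.1 hj; omega
          refine ⟨i', ?_, hm⟩
          by_contra hi'U
          have h3 := hmax i' (Finset.mem_sdiff.2 ⟨Finset.mem_range.2 hi', hi'U⟩)
          have h4 := length_lt_length_flatMap (symVal E) _
            (fun x hx => hE.one_le hg.wellFormed hi' hx) (hg.longRules i' hi') hm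
          rw [hE.rule i' hi'] at h4
          have : (E i).length < (E i').length := h4
          omega
      rw [← hperm, Multiset.mem_add] at hocc
      have hiY : (Sum.inr i : GSym α) ∈ Y := by
        rcases hocc with h | h
        · exact h
        · obtain ⟨i', hi', he⟩ := Multiset.mem_map.1 h
          rw [Sum.inr.injEq] at he
          exact absurd (he ▸ hi') hiU
      obtain ⟨A, B, rfl⟩ := List.append_of_mem hiY
      obtain ⟨J', hJ', hadj'⟩ := adj_replace A (g.str (i + 1)) B (Sum.inr i)
      refine ⟨insert i U, Finset.insert_subset hir hU, by
        rw [Finset.card_insert_of_notMem hiU, hcard], A ++ g.str (i + 1) ++ B, ?_, ?_,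
        J + J', by rw [Multiset.card_add]; omega, ?_⟩
      · rw [← hY, List.flatMap_append, List.flatMap_append, List.flatMap_append, List.flatMap_cons,
          hE.rule i hir', List.append_assoc]
        rfl
      · rw [Finset.insert_val_of_notMem hiU, Finset.sum_insert hiU, Multiset.map_cons]
        rw [← Multiset.coe_add, ← Multiset.cons_coe] at hperm
        rw [← Multiset.coe_add, ← Multiset.coe_add, add_left_comm, ← hperm,
          ← Multiset.singleton_add, ← Multiset.singleton_add]
        abel
      · rw [Finset.sum_insert hiU]
        refine hadj'.trans ?_
        refine (add_le_add_left (add_le_add_left hadj _) _).trans (le_of_eq ?_)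
        abel
  obtain ⟨U, hU, hcard, Y, hY, hperm, J, hJ, hadj⟩ := key r le_rfl
  obtain rfl : U = Finset.range r := Finset.eq_of_subset_of_card_le hU (by simp [hcard])
  refine ⟨Y, hY, ?_, J, hJ, ?_⟩
  · rw [coe_rhs, Finset.sum_range_succ', add_comm (Finset.sum _ _)]
    exact hperm
  · rw [Finset.sum_range_succ', add_comm (Finset.sum _ _)]
    exact hadj

end Unroll

/-! ### Frequent pairs give large savings -/

section Pairs

variable {α : Type} [DecidableEq α]

/-- Replace from left to right. A replaced pair destroys at most one further occurrence, the one
that would start at its second symbol; hence the factor 2. -/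
theorem exists_pair_replace (x y z : GSym α) (n : ℕ) (s : List (GSym α)) (hn : s.length ≤ n)
    (hz : z ∉ s) : ∃ s', FullGrammar.unfold z [x, y] s' = s ∧
      (adj s : Multiset (GSym α × GSym α)).count (x, y) ≤ 2 * s'.count z := by
  induction n generalizing s with
  | zero =>
    obtain rfl : s = [] := List.length_eq_zero_iff.1 (by omega)
    exact ⟨[], rfl, by simp [adj]⟩
  | succ n ih =>
    match s with
    | [] => exact ⟨[], rfl, by simp [adj]⟩
    | [a] => exact ⟨[a], unfold_of_notMem hz _, by simp [adj]⟩
    | a :: b :: t =>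
      have hza : a ≠ z := fun h => hz (by simp [h])
      by_cases hab : (a, b) = (x, y)
      · obtain ⟨rfl, rfl⟩ : a = x ∧ b = y := by simpa using hab
        obtain ⟨s', h1, h2⟩ := ih t (by simp at hn; omega) (fun h => hz (by simp [h]))
        refine ⟨z :: s', by rw [unfold_cons_self, h1]; rfl, ?_⟩
        rw [List.count_cons_self]
        obtain ⟨J, hJ, hadj⟩ := adj_append [a, b] t
        have h3 : (adj (a :: b :: t) : Multiset (GSym α × GSym α)).count (a, b) ≤
            1 + (adj t : Multiset (GSym α × GSym α)).count (a, b) + 1 := by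
          rw [show a :: b :: t = [a, b] ++ t from rfl, hadj, Multiset.count_add,
            Multiset.count_add]
          have h4 := (Multiset.count_le_card (a, b) J).trans hJ
          have h5 : (adj [a, b] : Multiset (GSym α × GSym α)).count (a, b) = 1 := by
            simp only [adj, Multiset.coe_singleton, Multiset.count_singleton_self]
          omega
        omega
      · obtain ⟨s', h1, h2⟩ := ih (b :: t) (by simp at hn ⊢; omega)
          (fun h => hz (List.mem_cons_of_mem _ h))
        refine ⟨a :: s', by rw [unfold_cons_of_ne hza, h1], ?_⟩
        rw [adj, ← Multiset.cons_coe, Multiset.count_cons_of_ne (Ne.symm hab),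
          List.count_cons_of_ne hza]
        exact h2

/-- If no replacement reduces the size by more than `F`, then all pairs are rare. -/
theorem count_adj_le {g : FullGrammar α} (hg : g.WellFormed) {F : ℕ}
    (hF : ∀ w g', Rep g w g' → g.size ≤ g'.size + F) (p : GSym α × GSym α) :
    (∑ j ∈ Finset.range (g.rules.length + 1), (adj (g.str j) : Multiset _)).count p ≤
      2 * (F + 2) := by
  obtain ⟨x, y⟩ := p
  choose! f hf1 hf2 using fun j (hj : j ≤ g.rules.length) =>
    exists_pair_replace x y g.freshSym _ (g.str j) le_rfl (hg.freshSym_notMem hj)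
  have h1 : (∑ j ∈ Finset.range (g.rules.length + 1),
      (adj (g.str j) : Multiset (GSym α × GSym α))).count (x, y) ≤
      2 * ∑ j ∈ Finset.range (g.rules.length + 1), (f j).count g.freshSym := by
    rw [Multiset.count_sum', Finset.mul_sum]
    exact Finset.sum_le_sum fun j hj =>
      hf2 j (Nat.lt_succ_iff.1 (Finset.mem_range.1 hj))
  refine h1.trans (Nat.mul_le_mul_left 2 ?_)
  -- Replacing f occurrences of a pair saves f - 2 symbols, so f ≤ F + 2.
  by_cases hc : 2 ≤ ∑ j ∈ Finset.range (g.rules.length + 1), (f j).count g.freshSym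
  · obtain ⟨g', h', hstr⟩ := exists_rep g [x, y] f le_rfl hf1 hc
    have h2 := hF _ _ h'
    have h3 := h'.size_eq
    have h4 : ∑ j ∈ Finset.range (g.rules.length + 1), (g'.str j).count g.freshSym =
        ∑ j ∈ Finset.range (g.rules.length + 1), (f j).count g.freshSym :=
      Finset.sum_congr rfl fun j hj => by
        rw [hstr j (Nat.lt_succ_iff.1 (Finset.mem_range.1 hj))]
    rw [h4] at h3
    simp only [List.length_cons, List.length_nil] at h3
    omega
  · omega

end Pairs

/-! ### Runs of Greedy; the number of late rounds -/

section Run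

variable {α : Type} [DecidableEq α]

theorem invariant_of_run {g₀ g : FullGrammar α} (h : Relation.ReflTransGen GreedyStep g₀ g)
    (h₀ : g₀.Invariant) : g.Invariant := by
  induction h with
  | refl => exact h₀
  | tail _ hs ih =>
    obtain ⟨w, hw⟩ := (greedyStep_iff _ _).1 hs
    exact ih.step hw

theorem size_le_of_run {g₀ g : FullGrammar α} (h : Relation.ReflTransGen GreedyStep g₀ g) :
    g.size ≤ g₀.size := by
  induction h with
  | refl => exact le_rfl
  | tail _ hs ih =>
    obtain ⟨w, hw⟩ := (greedyStep_iff _ _).1 hs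
    exact hw.size_le.trans ih

theorem length_rules_le_of_run {g₀ g : FullGrammar α}
    (h : Relation.ReflTransGen GreedyStep g₀ g) : g₀.rules.length ≤ g.rules.length := by
  induction h with
  | refl => exact le_rfl
  | tail _ hs ih =>
    obtain ⟨w, hw⟩ := (greedyStep_iff _ _).1 hs
    rw [hw.length_rules]; omega

theorem exists_isValuation_of_run {g₀ g : FullGrammar α}
    (h : Relation.ReflTransGen GreedyStep g₀ g) (h₀ : g₀.Invariant) {S : List α}
    (hE : ∃ E, g₀.IsValuation S E) : ∃ E, g.IsValuation S E := by
  induction h with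
  | refl => exact hE
  | tail hr hs ih =>
    obtain ⟨w, hw⟩ := (greedyStep_iff _ _).1 hs
    obtain ⟨E, hE⟩ := ih
    exact ⟨_, hE.step (invariant_of_run hr h₀).wellFormed hw.toRep⟩

theorem isValuation_of_run {g₀ g : FullGrammar α} (h : Relation.ReflTransGen GreedyStep g₀ g)
    {S : List α} {E : ℕ → List α} (hE : g.IsValuation S E) : g₀.IsValuation S E := by
  induction h with
  | refl => exact hE
  | tail _ hs ih =>
    obtain ⟨w, hw⟩ := (greedyStep_iff _ _).1 hs
    exact ih (hE.of_step hw.toRep)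

/-- The rounds that reduce the size by more than `F` come before all other rounds. -/
theorem exists_threshold {g₀ g : FullGrammar α} (h : Relation.ReflTransGen GreedyStep g₀ g)
    (ht : g.Terminal) (F : ℕ) : ∃ g₁, Relation.ReflTransGen GreedyStep g₀ g₁ ∧
      Relation.ReflTransGen GreedyStep g₁ g ∧
      g₁.rules.length * F + g₁.size ≤ g₀.rules.length * F + g₀.size ∧
      ∀ w g₂, Rep g₁ w g₂ → g₁.size ≤ g₂.size + F := by
  induction h using Relation.ReflTransGen.head_induction_on with
  | refl =>
    exact ⟨g, .refl, .refl, le_rfl, fun w g₂ h₂ =>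
      absurd ((isReplacement_iff_rep _ _ _).2 h₂) (ht w g₂)⟩
  | @head g₀ g' hs hr ih =>
    -- Stop at the first grammar with this property. Before that, some replacement saves more than
    -- `F`, hence so does Greedy's step; this pays for the new rule in the potential rules · F +
    -- size.
    by_cases hall : ∀ w g₂, Rep g₀ w g₂ → g₀.size ≤ g₂.size + F
    · exact ⟨g₀, .refl, .head hs hr, le_rfl, hall⟩
    · push Not at hall
      obtain ⟨w₂, g₂, h₂, hlt⟩ := hall
      obtain ⟨w, hw⟩ := (greedyStep_iff _ _).1 hs
      obtain ⟨g₁, h1, h2, h3, h4⟩ := ih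
      have h5 := hw.minimal _ _ h₂
      rw [hw.length_rules, add_mul, one_mul] at h3
      exact ⟨g₁, .head hs h1, h2, by omega, h4⟩

/-- The multiplicities of the strings in the expansion of the grammar to the symbols of `g₀`. -/
theorem exists_weights {g₀ g : FullGrammar α} (h : Relation.ReflTransGen GreedyStep g₀ g)
    (h₀ : g₀.Invariant) : ∃ c : ℕ → ℕ, (∀ j ≤ g.rules.length, 1 ≤ c j) ∧
      (∀ j ≤ g₀.rules.length, c j = 1) ∧
      (∑ j ∈ Finset.range (g.rules.length + 1), c j * (g.str j).length =
        g₀.size + ∑ j ∈ Finset.Ico (g₀.rules.length + 1) (g.rules.length + 1), c j) ∧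
      ∀ i, g₀.rules.length ≤ i → i < g.rules.length → c (i + 1) =
        ∑ j ∈ Finset.range (g.rules.length + 1), c j * (g.str j).count (Sum.inr i) := by
  induction h with
  | refl => exact ⟨fun _ => 1, by simp, by simp, by simp [size_eq_sum], fun i h1 h2 => by omega⟩
  | @tail g g' hr hs ih =>
    obtain ⟨w, hw⟩ := (greedyStep_iff _ _).1 hs
    obtain ⟨c, c1, c2, c3, c4⟩ := ih
    have hg := invariant_of_run hr h₀
    have hle := length_rules_le_of_run hr
    set r := g.rules.length with hrdef
    -- The new right-hand side is used as often as its nonterminal occurs, each occurrence counted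
    -- with the weight of its string.
    set C := ∑ j ∈ Finset.range (r + 1), c j * (g'.str j).count g.freshSym with hC
    have hupd : ∀ j ≤ r, Function.update c (r + 1) C j = c j := fun j hj =>
      Function.update_of_ne (by omega) _ _
    have hsum : ∀ f : ℕ → ℕ, ∑ j ∈ Finset.range (r + 1), Function.update c (r + 1) C j * f j =
        ∑ j ∈ Finset.range (r + 1), c j * f j := fun f => Finset.sum_congr rfl fun j hj => by
      rw [hupd j (Nat.lt_succ_iff.1 (Finset.mem_range.1 hj))]
    refine ⟨Function.update c (r + 1) C, ?_, ?_, ?_, ?_⟩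
    · intro j hj
      rw [hw.length_rules] at hj
      by_cases hj' : j ≤ r
      · rw [hupd j hj']; exact c1 j hj'
      · obtain rfl : j = r + 1 := by omega
        rw [Function.update_self]
        refine (Nat.le_succ 1).trans (hw.two_le_count.trans (Finset.sum_le_sum fun j hj => ?_))
        exact Nat.le_mul_of_pos_left _ (c1 j (Nat.lt_succ_iff.1 (Finset.mem_range.1 hj)))
    · intro j hj
      rw [hupd j (by omega)]; exact c2 j hj
    · rw [hw.length_rules, ← hrdef, Finset.sum_range_succ, Finset.sum_Ico_succ_top (by omega), hsum,
        Function.update_self, hw.str_last]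
      rw [Finset.sum_congr rfl (g := fun j => c j) fun j hj => hupd j (by
        have := (Finset.mem_Ico.1 hj).2; omega)]
      have h1 : ∑ j ∈ Finset.range (r + 1), c j * (g.str j).length + C =
          ∑ j ∈ Finset.range (r + 1), c j * (g'.str j).length + C * w.length := by
        rw [hC, Finset.sum_mul, ← Finset.sum_add_distrib, ← Finset.sum_add_distrib]
        refine Finset.sum_congr rfl fun j hj => ?_
        rw [← mul_add, hw.length_str (Nat.lt_succ_iff.1 (Finset.mem_range.1 hj))]
        ring
      omega
    · intro i hi1 hi2
      rw [hw.length_rules] at hi2 ⊢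
      rw [Finset.sum_range_succ, hsum, Function.update_self, hw.str_last]
      rcases Nat.lt_succ_iff_lt_or_eq.1 hi2 with hi' | rfl
      · have hix : (Sum.inr i : GSym α) ≠ g.freshSym := by
          rw [freshSym, Ne, Sum.inr.injEq]; omega
        rw [hupd _ hi', c4 i hi1 hi', hC, Finset.sum_mul, ← Finset.sum_add_distrib]
        refine Finset.sum_congr rfl fun j hj => ?_
        rw [hw.count_str hix (Nat.lt_succ_iff.1 (Finset.mem_range.1 hj))]
        ring
      · rw [Function.update_self]
        have : w.count (Sum.inr r : GSym α) = 0 :=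
          List.count_eq_zero_of_not_mem (hw.freshSym_notMem hg.wellFormed)
        rw [this, mul_zero, add_zero]
        rfl

theorem sum_count_inr_le_length (s : List (GSym α)) (I : Finset ℕ) :
    ∑ i ∈ I, s.count (Sum.inr i) ≤ s.length := by
  induction s with
  | nil => simp
  | cons x s ih =>
    simp only [List.count_cons, Finset.sum_add_distrib, List.length_cons]
    refine Nat.add_le_add ih ?_
    cases x with
    | inl a => simp
    | inr i' =>
      refine (Finset.sum_le_sum (g := fun i => if i' = i then 1 else 0) fun i _ => ?_).trans ?_
      · by_cases h : i' = i <;> simp [h]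
      · rw [Finset.sum_ite_eq]; split_ifs <;> simp

/-- At most a quarter of the size is the number of later rounds. -/
theorem four_mul_rounds_le {g₀ g : FullGrammar α} (h : Relation.ReflTransGen GreedyStep g₀ g)
    (h₀ : g₀.Invariant) : 4 * (g.rules.length - g₀.rules.length) ≤ g₀.size := by
  obtain ⟨c, c1, c2, c3, c4⟩ := exists_weights h h₀
  have hg := invariant_of_run h h₀
  have hle := length_rules_le_of_run h
  set r := g.rules.length
  set r₀ := g₀.rules.length
  have hsplit : ∀ f : ℕ → ℕ, ∑ j ∈ Finset.range (r + 1), f j =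
      ∑ j ∈ Finset.range (r₀ + 1), f j + ∑ j ∈ Finset.Ico (r₀ + 1) (r + 1), f j := fun f =>
    (Finset.sum_range_add_sum_Ico f (by omega)).symm
  have hshift : ∀ f : ℕ → ℕ, ∑ j ∈ Finset.Ico (r₀ + 1) (r + 1), f j =
      ∑ i ∈ Finset.Ico r₀ r, f (i + 1) := fun f => by
    rw [Finset.sum_Ico_add']
  have hc2 : ∀ i ∈ Finset.Ico r₀ r, 2 ≤ c (i + 1) := by
    intro i hi
    obtain ⟨h1, h2⟩ := Finset.mem_Ico.1 hi
    rw [c4 i h1 h2]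
    refine (hg.usedTwice i h2).trans (Finset.sum_le_sum fun j hj => ?_)
    exact Nat.le_mul_of_pos_left _ (c1 j (Nat.lt_succ_iff.1 (Finset.mem_range.1 hj)))
  have hroot : ∑ i ∈ Finset.Ico r₀ r, ∑ j ∈ Finset.range (r₀ + 1), (g.str j).count (Sum.inr i) ≤
      ∑ j ∈ Finset.range (r₀ + 1), c j * (g.str j).length := by
    rw [Finset.sum_comm]
    refine Finset.sum_le_sum fun j hj => ?_
    rw [c2 j (Nat.lt_succ_iff.1 (Finset.mem_range.1 hj)), one_mul]
    exact sum_count_inr_le_length _ _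
  have hlong : 2 * ∑ i ∈ Finset.Ico r₀ r, c (i + 1) ≤
      ∑ i ∈ Finset.Ico r₀ r, c (i + 1) * (g.str (i + 1)).length := by
    rw [Finset.mul_sum]
    refine Finset.sum_le_sum fun i hi => ?_
    rw [mul_comm]
    exact Nat.mul_le_mul_left _ (hg.longRules i (Finset.mem_Ico.1 hi).2)
  -- Let a be the number of occurrences of `i` in old strings and b that in new right-hand sides.
  -- Then a + b ≥ 2, and `c (i + 1)` ≥ a + 2b because new strings have weight at least 2. So a + `c
  -- (i + 1)` ≥ 2(a + b) ≥ 4.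
  have hfour : ∀ i ∈ Finset.Ico r₀ r,
      4 ≤ ∑ j ∈ Finset.range (r₀ + 1), (g.str j).count (Sum.inr i) + c (i + 1) := by
    intro i hi
    obtain ⟨h1, h2⟩ := Finset.mem_Ico.1 hi
    have h3 := hg.usedTwice i h2
    have h4 := c4 i h1 h2
    rw [hsplit] at h3 h4
    have h5 : ∑ j ∈ Finset.range (r₀ + 1), c j * (g.str j).count (Sum.inr i) =
        ∑ j ∈ Finset.range (r₀ + 1), (g.str j).count (Sum.inr i) :=
      Finset.sum_congr rfl fun j hj => by
        rw [c2 j (Nat.lt_succ_iff.1 (Finset.mem_range.1 hj)), one_mul]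
    have h6 : 2 * ∑ j ∈ Finset.Ico (r₀ + 1) (r + 1), (g.str j).count (Sum.inr i) ≤
        ∑ j ∈ Finset.Ico (r₀ + 1) (r + 1), c j * (g.str j).count (Sum.inr i) := by
      rw [Finset.mul_sum, hshift, hshift]
      exact Finset.sum_le_sum fun i' hi' => Nat.mul_le_mul_right _ (hc2 i' hi')
    omega
  -- Sum over the new nonterminals: the old occurrences number at most the total old length, and ∑ c
  -- ≤ ∑ c · length - ∑ c over the new strings since lengths are at least 2. By `c3` the two bounds
  -- add up to `g₀.size`.
  have hfour' := Finset.card_nsmul_le_sum _ _ _ hfour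
  rw [Nat.card_Ico, smul_eq_mul, Finset.sum_add_distrib] at hfour'
  rw [hsplit, hshift, hshift] at c3
  omega

end Run

end FullGrammar

/-! ### Left-to-right replacement is compatible with passing to factors -/

namespace FullGrammar

section ReplaceLeft

variable {α : Type} [DecidableEq α]

theorem replaceLeft_of_prefix {w : List (GSym α)} (hw : w ≠ []) (x : GSym α) (t : List (GSym α)) :
    replaceLeft w x (w ++ t) = x :: replaceLeft w x t := by
  obtain ⟨b, w', rfl⟩ := List.exists_cons_of_ne_nil hw
  rw [List.cons_append, replaceLeft, if_pos ⟨t, rfl⟩]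
  simp

theorem replaceLeft_of_not_prefix {w : List (GSym α)} (x a : GSym α) (t : List (GSym α))
    (h : ¬ w <+: a :: t) : replaceLeft w x (a :: t) = a :: replaceLeft w x t := by
  rw [replaceLeft, if_neg h]

theorem replaceLeft_of_not_infix {w : List (GSym α)} (x : GSym α) (s : List (GSym α))
    (h : ¬ w <:+: s) : replaceLeft w x s = s := by
  induction s with
  | nil => rw [replaceLeft]
  | cons a s ih =>
    rw [replaceLeft_of_not_prefix _ _ _ fun hp => h hp.isInfix,
      ih fun hi => h (hi.trans (List.suffix_cons a s).isInfix)]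

/-- A word is either empty, or starts with `w`, or starts with a symbol that is kept. -/
theorem replaceLeft_cases (w s : List (GSym α)) :
    s = [] ∨ (∃ t, s = w ++ t) ∨ (∃ a t, s = a :: t ∧ ¬ w <+: a :: t) := by
  cases s with
  | nil => exact Or.inl rfl
  | cons a t =>
    by_cases h : w <+: a :: t
    · obtain ⟨t', ht⟩ := h
      exact Or.inr (Or.inl ⟨t', ht.symm⟩)
    · exact Or.inr (Or.inr ⟨a, t, rfl, h⟩)

theorem unfold_replaceLeft {w : List (GSym α)} (hw : w ≠ []) {x : GSym α} (n : ℕ)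
    (s : List (GSym α)) (hn : s.length ≤ n) (hx : x ∉ s) :
    FullGrammar.unfold x w (replaceLeft w x s) = s := by
  induction n generalizing s with
  | zero =>
    obtain rfl : s = [] := List.length_eq_zero_iff.1 (by omega)
    rw [replaceLeft, unfold_nil]
  | succ n ih =>
    have hwl := List.length_pos_of_ne_nil hw
    rcases replaceLeft_cases w s with rfl | ⟨t, rfl⟩ | ⟨a, t, rfl, h⟩
    · rw [replaceLeft, unfold_nil]
    · rw [replaceLeft_of_prefix hw, unfold_cons_self,
        ih t (by simp at hn; omega) fun h => hx (by simp [h])]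
    · rw [replaceLeft_of_not_prefix _ _ _ h, unfold_cons_of_ne fun h => hx (by simp [h]),
        ih t (by simp at hn; omega) fun h => hx (by simp [h])]

/-- Cutting off the end creates no new occurrence of `w`, so the replacement proceeds as before up
to the cut. -/
theorem replaceLeft_unfold_prefix {w : List (GSym α)} (hw : w ≠ []) {x : GSym α} (n : ℕ)
    (s u B : List (GSym α)) (hn : s.length ≤ n) (hx : x ∉ s) (h : replaceLeft w x s = u ++ B) :
    replaceLeft w x (FullGrammar.unfold x w u) = u := by
  induction n generalizing s u with
  | zero =>
    obtain rfl : s = [] := List.length_eq_zero_iff.1 (by omega)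
    rw [replaceLeft] at h
    obtain rfl : u = [] := (List.append_eq_nil_iff.1 h.symm).1
    rw [unfold_nil, replaceLeft]
  | succ n ih =>
    have hwl := List.length_pos_of_ne_nil hw
    cases u with
    | nil => rw [unfold_nil, replaceLeft]
    | cons y u =>
      rcases replaceLeft_cases w s with rfl | ⟨t, rfl⟩ | ⟨a, t, rfl, hp⟩
      · rw [replaceLeft] at h; simp at h
      · rw [replaceLeft_of_prefix hw] at h
        obtain ⟨rfl, h1⟩ := List.cons.inj h
        rw [unfold_cons_self, replaceLeft_of_prefix hw,
          ih t u (by simp at hn; omega) (fun h => hx (by simp [h])) h1]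
      · rw [replaceLeft_of_not_prefix _ _ _ hp] at h
        obtain ⟨rfl, h1⟩ := List.cons.inj h
        have hxt : x ∉ t := fun h => hx (by simp [h])
        rw [unfold_cons_of_ne fun h => hx (by simp [h]), replaceLeft_of_not_prefix,
          ih t u (by simp at hn; omega) hxt h1]
        intro hp'
        apply hp
        refine hp'.trans ?_
        rw [List.cons_prefix_cons]
        refine ⟨rfl, FullGrammar.unfold x w B, ?_⟩
        have h2 : replaceLeft w x t = u ++ B := h1
        rw [← unfold_append, ← h2, unfold_replaceLeft hw _ _ le_rfl hxt]

/-- After each symbol it outputs, the left-to-right replacement starts afresh, with no memory of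
what came before. -/
theorem replaceLeft_unfold_suffix {w : List (GSym α)} (hw : w ≠ []) {x : GSym α} (n : ℕ)
    (s A C : List (GSym α)) (hn : s.length ≤ n) (hx : x ∉ s) (h : replaceLeft w x s = A ++ C) :
    replaceLeft w x (FullGrammar.unfold x w C) = C := by
  induction n generalizing s A with
  | zero =>
    obtain rfl : s = [] := List.length_eq_zero_iff.1 (by omega)
    rw [replaceLeft] at h
    obtain rfl : C = [] := (List.append_eq_nil_iff.1 h.symm).2
    rw [unfold_nil, replaceLeft]
  | succ n ih =>
    have hwl := List.length_pos_of_ne_nil hw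
    cases A with
    | nil =>
      rw [List.nil_append] at h
      rw [← h, unfold_replaceLeft hw _ _ le_rfl hx]
    | cons y A =>
      rcases replaceLeft_cases w s with rfl | ⟨t, rfl⟩ | ⟨a, t, rfl, hp⟩
      · rw [replaceLeft] at h; simp at h
      · rw [replaceLeft_of_prefix hw] at h
        exact ih t A (by simp at hn; omega) (fun h => hx (by simp [h])) (List.cons.inj h).2
      · rw [replaceLeft_of_not_prefix _ _ _ hp] at h
        exact ih t A (by simp at hn; omega) (fun h => hx (by simp [h])) (List.cons.inj h).2

theorem replaceLeft_unfold_infix {w : List (GSym α)} (hw : w ≠ []) {x : GSym α}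
    (s u : List (GSym α)) (hx : x ∉ s) (h : u <:+: replaceLeft w x s) :
    replaceLeft w x (FullGrammar.unfold x w u) = u := by
  obtain ⟨A, B, h⟩ := h
  have h1 := replaceLeft_unfold_suffix hw _ s A (u ++ B) le_rfl hx (by rw [← h, List.append_assoc])
  refine replaceLeft_unfold_prefix hw _ (FullGrammar.unfold x w (u ++ B)) u B le_rfl ?_ h1
  have h2 : FullGrammar.unfold x w (replaceLeft w x s) = s := unfold_replaceLeft hw _ _ le_rfl hx
  rw [← h, List.append_assoc, unfold_append] at h2
  exact fun hm => hx (h2 ▸ List.mem_append_right _ hm)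

end ReplaceLeft

/-! ### Distinct expansions -/

section LeftRun

variable {α : Type} [DecidableEq α]

/-- In a run with left-to-right replacement, a word of letters determines the proper factors of
the strings that expand to it. -/
structure IsParsing (g : FullGrammar α) (E : ℕ → List α) (R : List α → List (GSym α)) : Prop where
  rule : ∀ i < g.rules.length, R (E i) = [Sum.inr i]
  factor : ∀ j ≤ g.rules.length, ∀ u, u <:+: g.str j → (j = 0 ∨ u.length < (g.str j).length) →
    R (u.flatMap (symVal E)) = u

/-- If `w` were an entire right-hand side, that string would hold at most one replaced occurrence;
another string would then contain it, against `NoInfix`. -/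
theorem Rep.exists_proper_infix {g g' : FullGrammar α} {w : List (GSym α)} (h : Rep g w g')
    (hn : g.NoInfix) : ∃ j ≤ g.rules.length, w <:+: g.str j ∧
      (j = 0 ∨ w.length < (g.str j).length) := by
  obtain ⟨j, hj, hm⟩ := h.exists_mem'
  have hinf := h.infix_str hj hm
  rcases Nat.eq_zero_or_pos j with rfl | hj0
  · exact ⟨0, hj, hinf, Or.inl rfl⟩
  by_cases hlt : w.length < (g.str j).length
  · exact ⟨j, hj, hinf, Or.inr hlt⟩
  exfalso
  obtain ⟨i, rfl⟩ : ∃ i, j = i + 1 := ⟨j - 1, by omega⟩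
  have hle := hinf.length_le
  have heq : w = g.str (i + 1) := hinf.eq_of_length (by omega)
  have hc : (g'.str (i + 1)).count g.freshSym ≤ 1 := by
    have h1 := h.length_str hj
    have h2 : (g'.str (i + 1)).count g.freshSym ≤ (g'.str (i + 1)).length :=
      List.count_le_length
    rw [← heq] at h1
    by_contra hc
    have h3 : 2 * w.length ≤ (g'.str (i + 1)).count g.freshSym * w.length :=
      Nat.mul_le_mul_right _ (by omega)
    have h4 := h.two_le
    omega
  obtain ⟨j', hj', hne, hm'⟩ := h.exists_mem hc
  refine hn i hj j' hj' hne ?_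
  rw [← heq]
  exact h.infix_str hj' hm'

/-- The new parsing map applies the replacement after the old one. Factors of a rewritten string
unfold to factors of the old string, and rewriting them in isolation gives them back. The old map
sends the expansion of `w` to `w`, as `w` is a proper factor or lies in the starting string; now it
becomes the fresh symbol. Entire right-hand sides must be left out of `factor`, for their expansions
parse to the nonterminal. -/
theorem IsParsing.step {g g' : FullGrammar α} {E : ℕ → List α}
    {R : List α → List (GSym α)} (hR : g.IsParsing E R)
    (hg : g.Invariant) {w : List (GSym α)} (h : Rep g w g')
    (hl : ∀ j ≤ g.rules.length, g'.str j = replaceLeft w g.freshSym (g.str j)) :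
    g'.IsParsing (Function.update E g.rules.length (w.flatMap (symVal E)))
      (fun v => replaceLeft w g.freshSym (R v)) := by
  set E' := Function.update E g.rules.length (w.flatMap (symVal E)) with hE'
  have hZ := h.freshSym_notMem hg.wellFormed
  have hw0 : w ≠ [] := by rintro rfl; simpa using h.two_le
  obtain ⟨j₀, hj₀, hinf₀, hprop₀⟩ := h.exists_proper_infix hg.noInfix
  refine ⟨fun i hi => ?_, fun j hj u hu hprop => ?_⟩
  · rw [h.length_rules] at hi
    rcases Nat.lt_succ_iff_lt_or_eq.1 hi with hi' | rfl
    · rw [hE', Function.update_of_ne (by omega), hR.rule i hi']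
      refine replaceLeft_of_not_infix _ _ fun hi => ?_
      have h1 := hi.length_le
      have h2 := h.two_le
      simp only [List.length_singleton] at h1
      omega
    · rw [hE', Function.update_self, hR.factor j₀ hj₀ w hinf₀ hprop₀]
      have := replaceLeft_of_prefix hw0 g.freshSym []
      rw [List.append_nil, replaceLeft] at this
      exact this
  · rw [h.length_rules] at hj
    by_cases hj' : j ≤ g.rules.length
    · have hnot := hg.wellFormed.freshSym_notMem hj'
      rw [hl j hj'] at hu
      have h1 := replaceLeft_unfold_infix hw0 _ u hnot hu
      have h2 := unfold_infix hu g.freshSym w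
      rw [unfold_replaceLeft hw0 _ _ le_rfl hnot] at h2
      have hval : symVal E' g.freshSym = w.flatMap (symVal E') := by
        rw [flatMap_symVal_update hZ]
        simp [symVal, freshSym, E']
      have h3 : u.flatMap (symVal E') =
          (FullGrammar.unfold g.freshSym w u).flatMap (symVal E) := by
        rw [← flatMap_unfold (symVal E') g.freshSym w u hval, flatMap_symVal_update
          fun hm => hnot (h2.subset hm)]
      rw [h3, hR.factor j hj' _ h2, h1]
      refine hprop.imp_right fun hlt => ?_
      rw [hl j hj'] at hlt
      obtain ⟨A, B, hAB⟩ := hu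
      have h4 := unfold_replaceLeft hw0 _ _ le_rfl hnot
      rw [← hAB] at h4 hlt
      rw [← h4, unfold_append, unfold_append]
      have hmono : ∀ v : List (GSym α),
          v.length ≤ (FullGrammar.unfold g.freshSym w v).length := by
        intro v
        have h5 := length_unfold g.freshSym w v
        have h6 : v.count g.freshSym * 1 ≤ v.count g.freshSym * w.length :=
          Nat.mul_le_mul_left _ (by have := h.two_le; omega)
        omega
      have hA := hmono A
      have hB := hmono B
      simp only [List.length_append] at hlt ⊢
      omega
    · obtain rfl : j = g.rules.length + 1 := by omega
      rw [h.str_last] at hu hprop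
      have hlt : u.length < w.length := by
        rcases hprop with h0 | h0
        · omega
        · exact h0
      rw [flatMap_symVal_update fun hm => hZ (hu.subset hm),
        hR.factor j₀ hj₀ u (hu.trans hinf₀) (Or.inr (hlt.trans_le hinf₀.length_le))]
      exact replaceLeft_of_not_infix _ _ fun hi => by
        have := hi.length_le; omega

theorem LeftGreedyStep.exists_gRep {g g' : FullGrammar α} (h : LeftGreedyStep g g') :
    ∃ w, GRep g w g' ∧
      ∀ j ≤ g.rules.length, g'.str j = replaceLeft w g.freshSym (g.str j) := by
  obtain ⟨h1, w', hw'⟩ := h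
  obtain ⟨w, hw⟩ := (greedyStep_iff _ _).1 h1
  obtain rfl : w = w' := by
    have := hw.str_last
    rw [hw'] at this
    simpa [str] using this.symm
  refine ⟨w, hw, fun j hj => ?_⟩
  rw [hw']
  cases j with
  | zero => rfl
  | succ i =>
    have hi : i < g.rules.length := hj
    simp only [str]
    rw [List.getD_append _ _ _ _ (by simpa using hi)]
    simp [hi]

omit [DecidableEq α] in
theorem isParsing_ofString (S : List α) :
    (ofString S).IsParsing (fun _ => []) (fun v => v.map Sum.inl) where
  rule i hi := by simp [ofString] at hi
  factor j hj u hu hprop := by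
    clear hprop
    obtain rfl : j = 0 := by simpa [ofString] using hj
    have hu' : ∀ x ∈ u, ∃ a : α, x = Sum.inl a := fun x hx => by
      have := hu.subset hx
      simp only [str, ofString, List.mem_map] at this
      obtain ⟨a, -, rfl⟩ := this
      exact ⟨a, rfl⟩
    clear hu
    induction u with
    | nil => rfl
    | cons x u ih =>
      obtain ⟨a, rfl⟩ := hu' x List.mem_cons_self
      rw [List.flatMap_cons, List.map_append, ih fun x hx => hu' x (List.mem_cons_of_mem _ hx)]
      rfl

theorem run_of_leftRun {g₀ g : FullGrammar α} (h : Relation.ReflTransGen LeftGreedyStep g₀ g) :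
    Relation.ReflTransGen GreedyStep g₀ g := by
  induction h with
  | refl => exact .refl
  | tail _ hs ih => exact ih.tail hs.1

theorem exists_isParsing_of_leftRun {S : List α} {g : FullGrammar α}
    (h : Relation.ReflTransGen LeftGreedyStep (ofString S) g) :
    ∃ E R, g.IsValuation S E ∧ g.IsParsing E R := by
  induction h with
  | refl => exact ⟨_, _, isValuation_ofString S, isParsing_ofString S⟩
  | tail hr hs ih =>
    obtain ⟨w, hw, hl⟩ := hs.exists_gRep
    obtain ⟨E, R, hE, hR⟩ := ih
    have hg := invariant_of_run (run_of_leftRun hr) (invariant_ofString S)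
    exact ⟨_, _, hE.step hg.wellFormed hw.toRep, hR.step hg hw.toRep hl⟩

/-- The expansions of the nonterminals exist and are distinct. -/
def HasDistinctValuation (g : FullGrammar α) (S : List α) : Prop :=
  ∃ E, g.IsValuation S E ∧ ∀ i < g.rules.length, ∀ j < g.rules.length, E i = E j → i = j

theorem LeftGreedyOutput.hasDistinctValuation {S : List α} {g : FullGrammar α}
    (h : LeftGreedyOutput S g) : g.HasDistinctValuation S := by
  obtain ⟨E, R, hE, hR⟩ := exists_isParsing_of_leftRun h.1
  refine ⟨E, hE, fun i hi j hj hij => ?_⟩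
  have h1 := hR.rule i hi
  rw [hij, hR.rule j hj] at h1
  simpa using h1.symm

theorem GreedyOutput.hasDistinctValuation {S : List α} {g : FullGrammar α}
    (h : GreedyOutput S g) (hd : g.DistinctExpansions) : g.HasDistinctValuation S := by
  have hg := invariant_of_run h.1 (invariant_ofString S)
  obtain ⟨E, hE⟩ := exists_isValuation_of_run h.1 (invariant_ofString S)
    ⟨_, isValuation_ofString S⟩
  refine ⟨E, hE, fun i hi j hj hij => hd i j (E i) (hE.expands hg.wellFormed hg.longRules hi) ?_⟩
  rw [hij]
  exact hE.expands hg.wellFormed hg.longRules hj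

end LeftRun

end FullGrammar

/-! ### Entropy of grammars and of pairs -/

namespace FullGrammar

section Pairs

theorem exists_flatMap_pairUp {β γ : Type*} (f : β → List γ) : ∀ l : List β, ∃ l' : List β,
    l'.length ≤ 1 ∧ l' ⊆ l ∧
      l.flatMap f = (pairUp l).flatMap (fun p => f p.1 ++ f p.2) ++ l'.flatMap f
  | [] => ⟨[], by simp, by simp, by simp [pairUp]⟩
  | [a] => ⟨[a], by simp, by simp, by simp [pairUp]⟩
  | a :: b :: l => by
    obtain ⟨l', h1, h2, h3⟩ := exists_flatMap_pairUp f l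
    refine ⟨l', h1, fun x hx => by simp [h2 hx], ?_⟩
    simp only [pairUp, List.flatMap_cons, h3, List.append_assoc]

end Pairs

section Entropy

variable {α : Type} [DecidableEq α] [Fintype α]

open Real

theorem length_mul_empEntropy_zero_le (S : List α) :
    (S.length : ℝ) * empEntropy 0 S ≤ S.length * logb 2 (Fintype.card α) := by
  rw [length_mul_empEntropy_zero]
  rcases isEmpty_or_nonempty α with hα | hα
  · have : S = [] := List.eq_nil_iff_forall_not_mem.2 fun a => isEmptyElim a
    simp [this]
  have hpos : (0 : ℝ) < Fintype.card α := by exact_mod_cast Fintype.card_pos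
  refine (gibbs_multiset (S : Multiset α) (fun _ => 1 / (Fintype.card α : ℝ))
    (fun _ _ => by positivity) ?_).trans (le_of_eq ?_)
  · rw [Finset.sum_const, nsmul_eq_mul, mul_one_div, div_le_one hpos]
    exact_mod_cast Finset.card_le_univ _
  · simp

-- Nonterminals expand to at least two letters, so they cannot clash with letters. Injectivity is
-- what lets phrase weights serve as weights of symbols.
omit [DecidableEq α] [Fintype α] in
theorem symVal_injOn {g : FullGrammar α} {S : List α} {E : ℕ → List α}
    (hE : g.IsValuation S E) (hg : g.WellFormed)
    (hinj : ∀ i < g.rules.length, ∀ j < g.rules.length, E i = E j → i = j)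
    {x y : GSym α} (hx : x ∈ g.rhs) (hy : y ∈ g.rhs) (h : symVal E x = symVal E y) : x = y := by
  have hlt : ∀ i, Sum.inr i ∈ g.rhs → i < g.rules.length := fun i hi => by
    obtain ⟨j, hj, hm⟩ := (mem_rhs_iff g _).1 hi
    exact hg j hj i hm
  cases x with
  | inl a =>
    cases y with
    | inl b => simpa [symVal] using h
    | inr j =>
      have h1 := hE.two_le j (hlt j hy)
      have h2 : [a] = E j := h
      rw [← h2] at h1; simp at h1
  | inr i =>
    cases y with
    | inl b =>
      have h1 := hE.two_le i (hlt i hx)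
      have h2 : E i = [b] := h
      rw [h2] at h1; simp at h1
    | inr j => rw [hinj i (hlt i hx) j (hlt j hy) h]

omit [DecidableEq α] [Fintype α] in
theorem IsValuation.symVal_ne_nil {g : FullGrammar α} {S : List α} {E : ℕ → List α}
    (hE : g.IsValuation S E) (hg : g.WellFormed) {x : GSym α} (hx : x ∈ g.rhs) :
    symVal E x ≠ [] := by
  obtain ⟨j, hj, hm⟩ := (mem_rhs_iff g _).1 hx
  exact List.ne_nil_of_length_pos (hE.one_le hg hj hm)

/-- The entropy of a grammar is at most the entropy of the string that it produces, plus
`log r` bits for each of the `r` nonterminals, plus terms of smaller order. -/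
theorem rhs_entropy_le {g : FullGrammar α} (hg : g.Invariant) {S : List α}
    (hd : g.HasDistinctValuation S) (k : ℕ) (B : ℝ) (hB : 1 ≤ B) :
    (g.rhs.length : ℝ) * empEntropy 0 g.rhs ≤ S.length * empEntropy k S +
      g.size * (k * logb 2 (Fintype.card α) + 3 * logb 2 B + 1) + 12 * S.length / B +
      g.rules.length * logb 2 g.rules.length := by
  obtain ⟨E, hE, hinj⟩ := hd
  obtain ⟨Y, hY, hperm, -⟩ := exists_unroll hg hE
  set r := g.rules.length with hr
  have hYmem : ∀ x ∈ Y, x ∈ g.rhs := fun x hx => by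
    rw [← Multiset.mem_coe, ← hperm, Multiset.mem_add]; exact Or.inl hx
  let N : Finset (GSym α) := (Finset.range r).image Sum.inr
  -- A mixture: symbols in the parsing `Y` are charged to the phrase model, and the `r` nonterminals
  -- removed by unrolling to the uniform half. The mixing costs one bit per symbol.
  let q : GSym α → ℝ := fun s => phraseWeight k S (symVal E s) / 2 +
    if s ∈ N then 1 / (2 * (r : ℝ)) else 0
  have hN0 : ∀ s, (0 : ℝ) ≤ if s ∈ N then 1 / (2 * (r : ℝ)) else 0 := fun s => by
    split_ifs <;> positivity
  have hNpos : ∀ i < r, (1 : ℝ) / (2 * r) ≤ q (Sum.inr i) := fun i hi => by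
    have h1 : (Sum.inr i : GSym α) ∈ N := Finset.mem_image.2 ⟨i, Finset.mem_range.2 hi, rfl⟩
    have h2 := phraseWeight_nonneg k S (symVal E (Sum.inr i))
    simp only [q, if_pos h1]
    linarith
  have hw : ∀ x ∈ Y, 0 < phraseWeight k S (symVal E x) := fun x hx => by
    refine (phraseWeight_pos_and_cost k S _ (hE.symVal_ne_nil hg.wellFormed (hYmem x hx)) ?_
      1 one_pos).1
    obtain ⟨A, C, rfl⟩ := List.append_of_mem hx
    rw [← hY, List.flatMap_append, List.flatMap_cons]
    exact ⟨A.flatMap (symVal E), C.flatMap (symVal E), by rw [List.append_assoc]⟩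
  have hqY : ∀ x ∈ Y, phraseWeight k S (symVal E x) / 2 ≤ q x := fun x _ => by
    have := hN0 x
    simp only [q]; linarith
  rw [length_mul_empEntropy_zero]
  have hgibbs := gibbs_multiset (g.rhs : Multiset (GSym α)) q ?_ ?_
  rotate_left
  · intro b hb
    rw [← hperm, Multiset.mem_add] at hb
    rcases hb with hb | hb
    · exact (half_pos (hw b hb)).trans_le (hqY b hb)
    · obtain ⟨i, hi, rfl⟩ := Multiset.mem_map.1 hb
      have hi' : i < r := Multiset.mem_range.1 hi
      have hr0 : (0 : ℝ) < r := by exact_mod_cast (Nat.zero_le i).trans_lt hi'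
      exact lt_of_lt_of_le (by positivity) (hNpos i hi')
  · simp only [q]
    rw [Finset.sum_add_distrib, ← Finset.sum_div]
    have h1 := sum_phraseWeight_le_one k S (g.rhs : Multiset (GSym α)).toFinset (symVal E)
      (fun _ => 0)
      (fun b hb => List.length_pos_of_ne_nil (hE.symVal_ne_nil hg.wellFormed (by simpa using hb)))
      (fun b hb b' hb' h _ => symVal_injOn hE hg.wellFormed hinj (by simpa using hb)
        (by simpa using hb') h)
    have h2 : ∑ s ∈ (g.rhs : Multiset (GSym α)).toFinset,
        (if s ∈ N then 1 / (2 * (r : ℝ)) else 0) ≤ 1 / 2 := by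
      rw [← Finset.sum_filter, Finset.sum_const, nsmul_eq_mul]
      have h3 : ({s ∈ (g.rhs : Multiset (GSym α)).toFinset | s ∈ N}).card ≤ r := by
        refine (Finset.card_le_card fun s hs => (Finset.mem_filter.1 hs).2).trans ?_
        exact Finset.card_image_le.trans (by simp)
      have h4 : ((({s ∈ (g.rhs : Multiset (GSym α)).toFinset | s ∈ N}).card : ℕ) : ℝ) ≤ r := by
        exact_mod_cast h3
      refine (mul_le_mul_of_nonneg_right h4 (by positivity)).trans ?_
      rcases Nat.eq_zero_or_pos r with h0 | h0
      · simp [h0]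
      · have : (0 : ℝ) < r := by exact_mod_cast h0
        apply le_of_eq; field_simp
    linarith
  refine hgibbs.trans ?_
  rw [← hperm, Multiset.map_add, Multiset.sum_add, Multiset.map_map]
  have hsize : g.size = Y.length + r := by
    have := congrArg Multiset.card hperm
    simpa [size] using this.symm
  have hlog : (0 : ℝ) ≤ k * logb 2 (Fintype.card α) + 3 * logb 2 B := by
    have h1 : 0 ≤ logb 2 B := logb_nonneg (by norm_num) hB
    have h2 : 0 ≤ logb 2 (Fintype.card α : ℝ) := by
      rcases Nat.eq_zero_or_pos (Fintype.card α) with h0 | h0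
      · simp [h0]
      · exact logb_nonneg (by norm_num) (by exact_mod_cast h0)
    positivity
  have hsumY : ((Y : Multiset (GSym α)).map fun b => -logb 2 (q b)).sum ≤
      S.length * empEntropy k S + Y.length * (k * logb 2 (Fintype.card α) + 3 * logb 2 B) +
        12 * S.length / B + Y.length := by
    have h1 := sum_phraseCost_le k S (Y.map (symVal E))
      (fun e he => by
        obtain ⟨x, hx, rfl⟩ := List.mem_map.1 he
        exact hE.symVal_ne_nil hg.wellFormed (hYmem x hx))
      (by rw [← hY, List.flatMap_def]) B (by linarith)
    rw [List.map_map, List.length_map] at h1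
    rw [Multiset.map_coe, Multiset.sum_coe]
    have h2 : (Y.map fun b => -logb 2 (q b)).sum ≤
        (Y.map ((fun e => -logb 2 (phraseWeight k S e)) ∘ symVal E)).sum + Y.length := by
      have h3 : (Y.map fun b => -logb 2 (q b)).sum ≤
          (Y.map fun b => -logb 2 (phraseWeight k S (symVal E b)) + 1).sum := by
        refine List.sum_le_sum fun x hx => ?_
        have h4 : logb 2 (phraseWeight k S (symVal E x) / 2) ≤ logb 2 (q x) :=
          logb_le_logb_of_le (by norm_num) (half_pos (hw x hx)) (hqY x hx)
        rw [logb_div (hw x hx).ne' (by norm_num), logb_self_eq_one (by norm_num)] at h4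
        linarith
      refine h3.trans (le_of_eq ?_)
      rw [List.sum_map_add]
      simp [Function.comp_def]
    linarith
  have hsumN : ((Multiset.range r).map ((fun b => -logb 2 (q b)) ∘ Sum.inr)).sum ≤
      r * (1 + logb 2 r) := by
    have h1 := Multiset.sum_le_card_nsmul
      ((Multiset.range r).map ((fun b => -logb 2 (q b)) ∘ Sum.inr)) (1 + logb 2 r) (by
        intro x hx
        obtain ⟨i, hi, rfl⟩ := Multiset.mem_map.1 hx
        have hi' : i < r := Multiset.mem_range.1 hi
        have hr0 : (0 : ℝ) < r := by exact_mod_cast (Nat.zero_le i).trans_lt hi'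
        have h4 : logb 2 (1 / (2 * r)) ≤ logb 2 (q (Sum.inr i)) :=
          logb_le_logb_of_le (by norm_num) (by positivity) (hNpos i hi')
        rw [one_div, logb_inv, logb_mul (by norm_num) hr0.ne',
          logb_self_eq_one (by norm_num)] at h4
        simp only [Function.comp_apply]
        linarith)
    rwa [Multiset.card_map, Multiset.card_range, nsmul_eq_mul] at h1
  rw [hsize]
  push_cast
  nlinarith [mul_nonneg (Nat.cast_nonneg r : (0 : ℝ) ≤ r) hlog]

/-- If the pairs of neighbouring symbols of a grammar are rare, then half of its size times
`log n` is essentially bounded by the entropy of the string. -/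
theorem pair_entropy_le {g : FullGrammar α} (hg : g.Invariant) {S : List α}
    (hd : g.HasDistinctValuation S) {F : ℕ}
    (hF : ∀ p : GSym α × GSym α,
      (∑ j ∈ Finset.range (g.rules.length + 1), (adj (g.str j) : Multiset _)).count p ≤ F) :
    ∃ K : ℕ, g.size ≤ 2 * K + 5 * g.rules.length + 1 ∧ 2 * K ≤ S.length ∧
      ∀ (k : ℕ) (B : ℝ), 1 ≤ B → (K : ℝ) * logb 2 (K / F) ≤ S.length * empEntropy k S +
        (K + 2 * g.rules.length + 1) * (k * logb 2 (Fintype.card α) + 3 * logb 2 B) +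
          12 * S.length / B := by
  obtain ⟨E, hE, hinj⟩ := hd
  obtain ⟨Y, hY, hperm, J, hJ, hadj⟩ := exists_unroll hg hE
  set r := g.rules.length with hr
  have hYmem : ∀ x ∈ Y, x ∈ g.rhs := fun x hx => by
    rw [← Multiset.mem_coe, ← hperm, Multiset.mem_add]; exact Or.inl hx
  let C : Multiset (GSym α × GSym α) := pairUp Y
  -- Discarding as many pairs as unrolling may have created leaves only multiplicities that occur in
  -- the grammar, hence at most `F`, at the price of at most 2r pairs.
  let G : Multiset (GSym α × GSym α) := C - J
  have hGC : G ≤ C := Multiset.sub_le_self C J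
  have hCmem : ∀ p ∈ C, p.1 ∈ Y ∧ p.2 ∈ Y := fun p hp => mem_of_mem_pairUp Y p hp
  have hGcount : ∀ p, G.count p ≤ F := fun p => by
    refine le_trans (Multiset.count_le_of_le p ?_) (hF p)
    rw [Multiset.sub_le_iff_le_add]
    exact (pairUp_le_adj Y).trans hadj
  have hCcard : C.card ≤ G.card + 2 * r := by
    have h1 : C ≤ G + J := by rw [← Multiset.sub_le_iff_le_add]
    have h2 := Multiset.card_le_card h1
    rw [Multiset.card_add] at h2
    omega
  have hsize : g.size = Y.length + r := by
    have := congrArg Multiset.card hperm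
    simpa [size] using this.symm
  have hCl : C.card = (pairUp Y).length := rfl
  have hne : ∀ x ∈ Y, symVal E x ≠ [] := fun x hx => hE.symVal_ne_nil hg.wellFormed (hYmem x hx)
  refine ⟨G.card, ?_, ?_, ?_⟩
  · have := length_le_pairUp Y
    omega
  · have h1 := two_mul_pairUp_le Y
    have h2 := Multiset.card_le_card hGC
    have h3 := length_le_length_flatMap (symVal E) Y
      fun x hx => List.length_pos_of_ne_nil (hne x hx)
    rw [hY] at h3
    omega
  intro k B hB
  let e : GSym α × GSym α → List α := fun p => symVal E p.1 ++ symVal E p.2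
  obtain ⟨l', hl1, hl2, hflat⟩ := exists_flatMap_pairUp (symVal E) Y
  have hL : ∀ x ∈ (pairUp Y).map e ++ l'.map (symVal E), x ≠ [] := by
    intro x hx
    rcases List.mem_append.1 hx with hx | hx
    · obtain ⟨p, hp, rfl⟩ := List.mem_map.1 hx
      intro h0
      exact hne p.1 (hCmem p hp).1 (List.append_eq_nil_iff.1 h0).1
    · obtain ⟨y, hy, rfl⟩ := List.mem_map.1 hx
      exact hne y (hl2 hy)
  have hLS : ((pairUp Y).map e ++ l'.map (symVal E)).flatten = S := by
    rw [List.flatten_append, ← List.flatMap_def, ← List.flatMap_def, ← hY, hflat]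
  have hcost := sum_phraseCost_le k S _ hL hLS B (by linarith)
  have hnonneg : ∀ x : List α, 0 ≤ -logb 2 (phraseWeight k S x) := fun x => by
    have := logb_nonpos (b := 2) (by norm_num) (phraseWeight_nonneg k S x)
      (phraseWeight_le_one k S x)
    linarith
  have hpos : ∀ p ∈ G, 0 < phraseWeight k S (e p) := fun p hp => by
    have hm : e p ∈ (pairUp Y).map e ++ l'.map (symVal E) :=
      List.mem_append_left _ (List.mem_map_of_mem (Multiset.mem_of_le hGC hp))
    refine (phraseWeight_pos_and_cost k S (e p) (hL _ hm) ?_ 1 one_pos).1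
    rw [← hLS]
    exact List.infix_of_mem_flatten hm
  -- Different pairs may have the same concatenated expansion; the length of the first part then
  -- distinguishes them.
  have hgibbs := gibbs_multiset G (fun p => phraseWeight k S (e p)) hpos
    (sum_phraseWeight_le_one k S _ e (fun p => (symVal E p.1).length)
      (fun p hp => by
        have h1 := Multiset.mem_of_le hGC (Multiset.mem_toFinset.1 hp)
        have h2 := List.length_pos_of_ne_nil (hne p.2 (hCmem p h1).2)
        simp only [e, List.length_append]; omega)
      (fun p hp p' hp' h1 h2 => by
        have m1 := hCmem p (Multiset.mem_of_le hGC (Multiset.mem_toFinset.1 hp))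
        have m2 := hCmem p' (Multiset.mem_of_le hGC (Multiset.mem_toFinset.1 hp'))
        obtain ⟨h3, h4⟩ := List.append_inj h1 h2
        exact Prod.ext
          (symVal_injOn hE hg.wellFormed hinj (hYmem _ m1.1) (hYmem _ m2.1) h3)
          (symVal_injOn hE hg.wellFormed hinj (hYmem _ m1.2) (hYmem _ m2.2) h4)))
  have hlow : (G.card : ℝ) * logb 2 (G.card / F) ≤
      ∑ p ∈ G.toFinset, (G.count p : ℝ) * logb 2 (G.card / G.count p) := by
    have h1 : (G.card : ℝ) = ∑ p ∈ G.toFinset, (G.count p : ℝ) := by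
      exact_mod_cast (Multiset.toFinset_sum_count_eq G).symm
    conv_lhs => rw [h1, Finset.sum_mul]
    rw [← h1]
    refine Finset.sum_le_sum fun p hp => ?_
    have hp' := Multiset.mem_toFinset.1 hp
    have hc : (0 : ℝ) < G.count p := by exact_mod_cast Multiset.count_pos.2 hp'
    have hn : (0 : ℝ) < G.card := by exact_mod_cast Multiset.card_pos_iff_exists_mem.2 ⟨p, hp'⟩
    have hle : (G.count p : ℝ) ≤ F := by exact_mod_cast hGcount p
    have hF0 : (0 : ℝ) < F := hc.trans_le hle
    refine mul_le_mul_of_nonneg_left (logb_le_logb_of_le (by norm_num) (by positivity) ?_) hc.le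
    exact div_le_div_of_nonneg_left hn.le hc hle
  have hGsum : (G.map fun p => -logb 2 (phraseWeight k S (e p))).sum ≤
      (((pairUp Y).map e ++ l'.map (symVal E)).map
        fun x => -logb 2 (phraseWeight k S x)).sum := by
    have h1 : (G.map fun p => -logb 2 (phraseWeight k S (e p))).sum ≤
        (C.map fun p => -logb 2 (phraseWeight k S (e p))).sum := by
      obtain ⟨D, hD⟩ := Multiset.le_iff_exists_add.1 hGC
      rw [hD, Multiset.map_add, Multiset.sum_add]
      have : 0 ≤ (D.map fun p => -logb 2 (phraseWeight k S (e p))).sum :=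
        Multiset.sum_nonneg fun x hx => by
          obtain ⟨p, -, rfl⟩ := Multiset.mem_map.1 hx
          exact hnonneg _
      linarith
    refine h1.trans ?_
    rw [List.map_append, List.sum_append, List.map_map]
    have h2 : (C.map fun p => -logb 2 (phraseWeight k S (e p))).sum =
        ((pairUp Y).map ((fun x => -logb 2 (phraseWeight k S x)) ∘ e)).sum := by
      simp only [C, Multiset.map_coe, Multiset.sum_coe]
      rfl
    rw [h2]
    have : 0 ≤ ((l'.map (symVal E)).map fun x => -logb 2 (phraseWeight k S x)).sum :=
      List.sum_nonneg fun x hx => by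
        obtain ⟨y, -, rfl⟩ := List.mem_map.1 hx
        exact hnonneg y
    linarith
  have hlog : (0 : ℝ) ≤ k * logb 2 (Fintype.card α) + 3 * logb 2 B := by
    have h1 : 0 ≤ logb 2 B := logb_nonneg (by norm_num) hB
    have h2 : 0 ≤ logb 2 (Fintype.card α : ℝ) := by
      rcases Nat.eq_zero_or_pos (Fintype.card α) with h0 | h0
      · simp [h0]
      · exact logb_nonneg (by norm_num) (by exact_mod_cast h0)
    positivity
  have hlen : ((((pairUp Y).map e ++ l'.map (symVal E)).length : ℕ) : ℝ) ≤ G.card + 2 * r + 1 := by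
    rw [List.length_append, List.length_map, List.length_map]
    have : (pairUp Y).length + l'.length ≤ G.card + 2 * r + 1 := by omega
    exact_mod_cast this
  have := mul_le_mul_of_nonneg_right hlen hlog
  linarith

end Entropy

end FullGrammar

/-! ### Collecting the error terms -/

namespace FullGrammar

open Real Filter Topology

/-- The lower-order terms of the bounds add up to a small multiple of `n λ`. -/
theorem bits_le_of_bounds {n L l lam η c h H₀ K r₁ r m M kl bits : ℝ}
    (hη : 0 < η) (hL : 15 ≤ L) (hl0 : 0 ≤ l) (hl1 : 6 * l + 2 ≤ L / 2)
    (hl2 : 3 * l + 3 + c ≤ η * L) (hc : 0 ≤ c) (hlam : 1 ≤ lam) (hn : L ^ 2 ≤ n)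
    (hkl : kl ≤ η * L) (hH : H₀ ≤ n * lam) (hK : 0 ≤ K)
    (hr₁ : 0 ≤ r₁) (hM0 : 0 ≤ M) (hM : M ≤ m) (hr₁n : r₁ * L ^ 2 ≤ n)
    (hm : m ≤ 2 * K + 5 * r₁ + 1) (hr : 4 * (r - r₁) ≤ m)
    (hK0 : K * L ≤ H₀ + K * (3 * l + 2) + (K + 2 * r₁ + 1) * (3 * l) + 14 * n / L)
    (hKk : K * L ≤ h + K * (3 * l + 2) + (K + 2 * r₁ + 1) * (kl + 3 * l) + 14 * n / L)
    (hbits : bits ≤ h + M * (kl + 3 * l + 1) + 12 * n / L + r * L + c * M + 2 * M) :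
    bits ≤ 3 / 2 * h + 50 * η * (n * lam) := by
  have hL0 : 0 < L := by linarith
  have hn0 : 0 < n := lt_of_lt_of_le (by positivity) hn
  set e := n / L with he
  have he0 : 0 < e := by positivity
  have e14 : 14 * n / L = 14 * e := by rw [he]; ring
  have e12 : 12 * n / L = 12 * e := by rw [he]; ring
  rw [e14] at hK0 hKk
  rw [e12] at hbits
  have hLe : L ≤ e := by rw [he, le_div_iff₀ hL0]; linarith [sq L]
  have hre : r₁ * L ≤ e := by rw [he, le_div_iff₀ hL0]; linarith
  have hen : e * 15 ≤ n := by
    rw [he, div_mul_eq_mul_div, div_le_iff₀ hL0]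
    exact mul_le_mul_of_nonneg_left hL hn0.le
  have h1η : 1 ≤ η * L := by linarith
  have heη : e ≤ η * n := by
    rw [he, div_le_iff₀ hL0]
    linarith [mul_le_mul_of_nonneg_left h1η hn0.le]
  have hnl : n ≤ n * lam := le_mul_of_one_le_right hn0.le hlam
  have hl12 : l ≤ L / 12 := by linarith
  -- A crude bound from the order-0 inequality, needed before the errors proportional to `K` can be
  -- called small. The terms in `K` absorb at most K L / 2, and `L ≥ 15` puts the remaining
  -- multiples of n / L below n.
  have hKL : K * L ≤ 4 * (n * lam) := by
    have a1 : K * (6 * l + 2) ≤ K * (L / 2) := mul_le_mul_of_nonneg_left hl1 hK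
    have a2 : r₁ * l ≤ r₁ * (L / 12) := mul_le_mul_of_nonneg_left hl12 hr₁
    linarith
  have hmL : m * L ≤ 9 * (n * lam) := by
    have := mul_le_mul_of_nonneg_right hm hL0.le
    linarith
  have hη_e : η * e ≤ η * (n * lam) := mul_le_mul_of_nonneg_left (by linarith) hη.le
  have heN : e ≤ η * (n * lam) := heη.trans (mul_le_mul_of_nonneg_left hnl hη.le)
  -- Now every error in the order-k inequality is `η` times a quantity already bounded by a multiple
  -- of `n * lam`.
  have hKk' : K * L ≤ h + 32 * η * (n * lam) := by
    have a1 : K * (3 * l + 2) ≤ K * (η * L) := mul_le_mul_of_nonneg_left (by linarith) hK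
    have a2 : (K + 2 * r₁ + 1) * (kl + 3 * l) ≤ (K + 2 * r₁ + 1) * (2 * (η * L)) :=
      mul_le_mul_of_nonneg_left (by linarith) (by positivity)
    have a3 : η * (K * L) ≤ η * (4 * (n * lam)) := mul_le_mul_of_nonneg_left hKL hη.le
    have a4 : η * (r₁ * L) ≤ η * e := mul_le_mul_of_nonneg_left hre hη.le
    have a5 : η * L ≤ η * e := mul_le_mul_of_nonneg_left hLe hη.le
    linarith
  -- Here the additional 1/2 arises: a quarter of a grammar size of about 2K.
  have hrL : r * L ≤ K * L / 2 + 5 / 2 * e := by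
    have a1 : 4 * (r - r₁) * L ≤ (2 * K + 5 * r₁ + 1) * L :=
      mul_le_mul_of_nonneg_right (hr.trans hm) hL0.le
    linarith
  have hMb : M * (kl + 3 * l + 1) + c * M + 2 * M ≤ 18 * η * (n * lam) := by
    have a1 : M * (kl + 3 * l + 3 + c) ≤ M * (2 * (η * L)) :=
      mul_le_mul_of_nonneg_left (by linarith) hM0
    have a2 : M * (2 * (η * L)) ≤ m * (2 * (η * L)) :=
      mul_le_mul_of_nonneg_right hM (by positivity)
    have a3 : η * (m * L) ≤ η * (9 * (n * lam)) := mul_le_mul_of_nonneg_left hmL hη.le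
    linarith
  linarith

/-- A bound on `K log n` from a bound on `K log (K / F)`. -/
theorem mul_logb_le_of_mul_logb_div_le {n K L F X : ℝ} (hL : 2 ≤ L) (hLn : L = logb 2 n)
    (hn : 0 < n) (hK : 0 ≤ K) (hF0 : 0 < F) (hF : F ≤ 4 * L ^ 2)
    (hX : K * logb 2 (K / F) ≤ X) :
    K * L ≤ X + K * (3 * logb 2 L + 2) + 2 * n / L := by
  have hL0 : 0 < L := by linarith
  rcases hK.eq_or_lt with rfl | hK0
  · have : 0 ≤ 2 * n / L := by positivity
    rw [zero_mul] at hX ⊢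
    linarith
  -- Bounding log(n / K) this way costs log L per pair and 2n / L in total, so no lower bound on `K`
  -- is needed.
  · have h1 := logb_le_logb_add_div (n / K) L (by positivity) hL0
    rw [logb_div hn.ne' hK0.ne', ← hLn] at h1
    rw [logb_div hK0.ne' hF0.ne'] at hX
    have h2 : logb 2 F ≤ 2 + 2 * logb 2 L := by
      refine (logb_le_logb_of_le (by norm_num) hF0 hF).trans (le_of_eq ?_)
      rw [logb_mul (by norm_num) (by positivity), logb_pow,
        show (4 : ℝ) = 2 ^ (2 : ℕ) by norm_num, logb_pow, logb_self_eq_one (by norm_num)]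
      push_cast; ring
    have h3 : K * (2 * (n / K) / L) = 2 * n / L := by field_simp
    have h4 := mul_le_mul_of_nonneg_left h1 hK
    have h5 := mul_le_mul_of_nonneg_left h2 hK
    rw [mul_add, h3] at h4
    nlinarith

theorem two_mul_length_rules_le {α : Type} {g : FullGrammar α} (h : g.LongRules) :
    2 * g.rules.length ≤ g.size := by
  rw [size_eq_sum, Finset.sum_range_succ']
  have := Finset.card_nsmul_le_sum (Finset.range g.rules.length)
    (fun i => (g.str (i + 1)).length) 2 fun i hi => h i (Finset.mem_range.1 hi)
  rw [Finset.card_range, smul_eq_mul] at this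
  omega

theorem sum_length_rules_le {α : Type} (g : FullGrammar α) :
    (g.rules.map fun r => r.length + 1).sum ≤ g.size + g.rules.length := by
  rw [List.sum_map_add, size, rhs, List.length_append, List.length_flatten]
  simp

/-- The entropy encoding of a greedy grammar, for all parameters. -/
theorem entropyBits_le {σ k : ℕ} {S : List (Fin σ)} {c η : ℝ} {g : FullGrammar (Fin σ)}
    (hrun : Relation.ReflTransGen GreedyStep (ofString S) g) (ht : g.Terminal)
    (hd : g.HasDistinctValuation S) (hσ : 2 ≤ σ) (hη : 0 < η)
    (hL : 15 ≤ logb 2 S.length) (hl1 : 6 * logb 2 (logb 2 S.length) + 2 ≤ logb 2 S.length / 2)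
    (hl2 : 3 * logb 2 (logb 2 S.length) + 3 + |c| ≤ η * logb 2 S.length)
    (hn : logb 2 S.length ^ 2 ≤ S.length)
    (hk : k * logb 2 σ ≤ η * logb 2 S.length) :
    g.entropyBits c ≤ 3 / 2 * ((S.length : ℝ) * empEntropy k S) +
      50 * η * ((S.length : ℝ) * logb 2 (σ : ℝ)) := by
  set L := logb 2 S.length with hLdef
  have hL0 : 0 < L := by linarith
  have hn0 : (0 : ℝ) < S.length := lt_of_lt_of_le (by positivity) hn
  have hinv := invariant_of_run hrun (invariant_ofString S)
  -- The threshold L² is large enough for the early rules to contribute only r₁ L ≤ n / L, and small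
  -- enough for its logarithm to be O(log L).
  obtain ⟨g₁, hrun₁, hrun₂, hthr, hF⟩ := exists_threshold hrun ht ⌈L ^ 2⌉₊
  have hinv₁ := invariant_of_run hrun₁ (invariant_ofString S)
  have hd₁ : g₁.HasDistinctValuation S := by
    obtain ⟨E, hE, hinj⟩ := hd
    have hle := length_rules_le_of_run hrun₂
    exact ⟨E, isValuation_of_run hrun₂ hE, fun i hi j hj h =>
      hinj i (by omega) j (by omega) h⟩
  have hsize₀ : (ofString S).size = S.length := by simp [ofString, size, rhs]
  have hrules₀ : (ofString S).rules.length = 0 := rfl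
  rw [hsize₀, hrules₀, zero_mul, zero_add] at hthr
  obtain ⟨K, hm, hKn, hK⟩ := pair_entropy_le hinv₁ hd₁ (count_adj_le hinv₁.wellFormed hF)
  have hfour := four_mul_rounds_le hrun₂ hinv₁
  have hrle := length_rules_le_of_run hrun₂
  have hM := size_le_of_run hrun₂
  have h2r := two_mul_length_rules_le hinv.longRules
  have hceil : L ^ 2 ≤ (⌈L ^ 2⌉₊ : ℝ) := Nat.le_ceil _
  have hceil' : (⌈L ^ 2⌉₊ : ℝ) < L ^ 2 + 1 := Nat.ceil_lt_add_one (by positivity)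
  have hFle : (((2 * (⌈L ^ 2⌉₊ + 2) : ℕ)) : ℝ) ≤ 4 * L ^ 2 := by
    push_cast; nlinarith
  have hFpos : (0 : ℝ) < ((2 * (⌈L ^ 2⌉₊ + 2) : ℕ) : ℝ) := by positivity
  have hrhs := rhs_entropy_le hinv hd k L (by linarith)
  rw [Fintype.card_fin] at hrhs
  have hpair : ∀ k', (K : ℝ) * L ≤ S.length * empEntropy k' S +
      (K + 2 * g₁.rules.length + 1) * (k' * logb 2 σ + 3 * logb 2 L) + 12 * S.length / L +
      K * (3 * logb 2 L + 2) + 2 * S.length / L := fun k' => by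
    have h1 := hK k' L (by linarith)
    rw [Fintype.card_fin] at h1
    exact mul_logb_le_of_mul_logb_div_le (by linarith) hLdef hn0 (Nat.cast_nonneg K) hFpos hFle h1
  have h14 : (12 : ℝ) * S.length / L + 2 * S.length / L = 14 * S.length / L := by ring
  have hlogr : (g.rules.length : ℝ) * logb 2 g.rules.length ≤ g.rules.length * L := by
    rcases Nat.eq_zero_or_pos g.rules.length with h0 | h0
    · simp [h0]
    · refine mul_le_mul_of_nonneg_left (logb_le_logb_of_le (by norm_num) (by exact_mod_cast h0) ?_)
        (Nat.cast_nonneg _)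
      have : g.rules.length ≤ S.length := by omega
      exact_mod_cast this
  have hunary : (((g.rules.map fun r => r.length + 1).sum : ℕ) : ℝ) ≤ 2 * g.size := by
    have := sum_length_rules_le g
    have : (g.rules.map fun r => r.length + 1).sum ≤ 2 * g.size := by omega
    exact_mod_cast this
  have hH0 := length_mul_empEntropy_zero_le S
  rw [Fintype.card_fin] at hH0
  have hlam : 1 ≤ logb 2 (σ : ℝ) := by
    rw [← logb_self_eq_one (b := 2) (by norm_num)]
    exact logb_le_logb_of_le (by norm_num) (by norm_num) (by exact_mod_cast hσ)
  have hr₁n : (g₁.rules.length : ℝ) * L ^ 2 ≤ S.length := by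
    have h1 : g₁.rules.length * ⌈L ^ 2⌉₊ ≤ S.length := by omega
    have h2 : (g₁.rules.length : ℝ) * ⌈L ^ 2⌉₊ ≤ S.length := by exact_mod_cast h1
    exact (mul_le_mul_of_nonneg_left hceil (Nat.cast_nonneg _)).trans h2
  refine bits_le_of_bounds (L := L) (l := logb 2 L) (c := |c|) (H₀ := S.length * empEntropy 0 S)
    (K := K) (r₁ := g₁.rules.length) (r := g.rules.length) (m := g₁.size) (M := g.size)
    (kl := k * logb 2 σ) hη hL (logb_nonneg (by norm_num) (by linarith)) hl1 hl2
    (abs_nonneg c) hlam hn hk hH0 (Nat.cast_nonneg _) (Nat.cast_nonneg _) (Nat.cast_nonneg _)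
    (by exact_mod_cast hM) hr₁n (by exact_mod_cast hm) ?_ ?_ ?_ ?_
  · have h1 : 4 * g.rules.length ≤ g₁.size + 4 * g₁.rules.length := by omega
    have h2 : (4 : ℝ) * g.rules.length ≤ g₁.size + 4 * g₁.rules.length := by exact_mod_cast h1
    linarith
  -- Order 0 gives the a priori bound on K L through H₀ ≤ log σ; order `k` gives the sharp one.
  · have := hpair 0
    rw [Nat.cast_zero, zero_mul, zero_add] at this
    linarith
  · have := hpair k
    linarith
  · have hcM : c * (g.rhs.length : ℝ) ≤ |c| * g.size :=
      mul_le_mul_of_nonneg_right (le_abs_self c) (Nat.cast_nonneg _)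
    unfold entropyBits
    linarith

theorem exists_forall_logb_bounds (c : ℝ) {η : ℝ} (hη : 0 < η) : ∃ N : ℕ, ∀ n : ℕ, N ≤ n →
    15 ≤ logb 2 n ∧ 6 * logb 2 (logb 2 n) + 2 ≤ logb 2 n / 2 ∧
      3 * logb 2 (logb 2 n) + 3 + c ≤ η * logb 2 n ∧ logb 2 n ^ 2 ≤ (n : ℝ) := by
  have hlog2 : 0 < log 2 := log_pos (by norm_num)
  have hsmall : ∀ κ : ℝ, 0 < κ → ∀ᶠ x : ℝ in atTop, logb 2 x ≤ κ * x := by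
    intro κ hκ
    have h1 := isLittleO_log_id_atTop.bound (mul_pos hκ hlog2)
    filter_upwards [h1, eventually_ge_atTop 1] with x hx hx1
    rw [norm_of_nonneg (log_nonneg hx1), id, norm_of_nonneg (by linarith)] at hx
    unfold logb
    rw [div_le_iff₀ hlog2]
    linarith
  have hsq : ∀ᶠ x : ℝ in atTop, logb 2 x ^ 2 ≤ x := by
    have h1 := (isLittleO_pow_log_id_atTop (n := 2)).bound (pow_pos hlog2 2)
    filter_upwards [h1, eventually_ge_atTop 1] with x hx hx1
    rw [norm_of_nonneg (by positivity), id, norm_of_nonneg (by linarith)] at hx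
    unfold logb
    rw [div_pow, div_le_iff₀ (by positivity)]
    linarith
  have hL : Tendsto (fun n : ℕ => logb 2 (n : ℝ)) atTop atTop :=
    (tendsto_logb_atTop (by norm_num)).comp tendsto_natCast_atTop_atTop
  have hall : ∀ᶠ L : ℝ in atTop, 15 ≤ L ∧ 6 * logb 2 L + 2 ≤ L / 2 ∧
      3 * logb 2 L + 3 + c ≤ η * L := by
    filter_upwards [hsmall (1 / 24) (by norm_num), hsmall (η / 6) (by positivity),
      eventually_ge_atTop 15, eventually_ge_atTop ((3 + c) * 2 / η)] with L h1 h2 h3 h4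
    rw [div_le_iff₀ hη] at h4
    exact ⟨h3, by linarith, by linarith⟩
  obtain ⟨N, hN⟩ := eventually_atTop.1
    ((hL.eventually hall).and (tendsto_natCast_atTop_atTop.eventually hsq))
  exact ⟨N, fun n hn => ⟨(hN n hn).1.1, (hN n hn).1.2.1, (hN n hn).1.2.2, (hN n hn).2⟩⟩

end FullGrammar

theorem mainTheorem8 (c ε : ℝ) (hε : 0 < ε) :
    ∃ δ : ℝ, 0 < δ ∧ ∃ N : ℕ, ∀ (σ k : ℕ) (S : List (Fin σ)),
      2 ≤ σ → N ≤ S.length → (k : ℝ) ≤ δ * Real.logb (σ : ℝ) (S.length : ℝ) →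
      (∀ g : FullGrammar (Fin σ), FullGrammar.GreedyOutput S g → g.DistinctExpansions →
        g.entropyBits c ≤
          3 / 2 * ((S.length : ℝ) * empEntropy k S) +
            ε * ((S.length : ℝ) * Real.logb 2 (σ : ℝ))) ∧
      (∀ g : FullGrammar (Fin σ), FullGrammar.LeftGreedyOutput S g →
        g.entropyBits c ≤
          3 / 2 * ((S.length : ℝ) * empEntropy k S) +
            ε * ((S.length : ℝ) * Real.logb 2 (σ : ℝ))) := by
  -- The 50 absorbs the constant of `bits_le_of_bounds`; the same `η` serves as `δ`, since k ≤ η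
  -- log_σ n means k log σ ≤ η log n.
  set η := ε / 50 with hηdef
  have hη : 0 < η := by positivity
  have hηε : 50 * η ≤ ε := by linarith
  obtain ⟨N, hN⟩ := FullGrammar.exists_forall_logb_bounds |c| hη
  refine ⟨η, hη, N, fun σ k S hσ hS hk => ?_⟩
  obtain ⟨h1, h2, h3, h4⟩ := hN S.length hS
  have hσ1 : (1 : ℝ) < σ := by exact_mod_cast hσ
  have hlam : 0 < Real.logb 2 (σ : ℝ) := Real.logb_pos (by norm_num) hσ1
  have hk' : k * Real.logb 2 σ ≤ η * Real.logb 2 S.length := by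
    have h5 := mul_le_mul_of_nonneg_right hk hlam.le
    have h6 : Real.logb σ S.length * Real.logb 2 σ = Real.logb 2 S.length := by
      have h7 : Real.log σ ≠ 0 := (Real.log_pos hσ1).ne'
      unfold Real.logb
      field_simp
    rwa [mul_assoc, h6] at h5
  have hfin : ∀ g : FullGrammar (Fin σ),
      Relation.ReflTransGen FullGrammar.GreedyStep (FullGrammar.ofString S) g → g.Terminal →
      g.HasDistinctValuation S → g.entropyBits c ≤
        3 / 2 * ((S.length : ℝ) * empEntropy k S) +
          ε * ((S.length : ℝ) * Real.logb 2 (σ : ℝ)) := by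
    intro g hrun ht hd
    refine (FullGrammar.entropyBits_le hrun ht hd hσ hη h1 h2 h3 h4 hk').trans ?_
    have : (0 : ℝ) ≤ S.length * Real.logb 2 (σ : ℝ) := by positivity
    have := mul_le_mul_of_nonneg_right hηε this
    linarith
  exact ⟨fun g hg hd => hfin g hg.1 hg.2 (hg.hasDistinctValuation hd),
    fun g hg => hfin g (FullGrammar.run_of_leftRun hg.1) hg.2 hg.hasDistinctValuation⟩
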